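/- Let $\alpha,\beta$ be complex numbers with $|\alpha|\ge|\beta|>1$, and let $H_{\alpha,\beta}=(\mathbb C^2\setminus 0)/\langle f\rangle$, $f(z_1,z_2)=(\alpha z_1,\beta z_2)$, be the corresponding primary Hopf surface of class $1$. Fix logarithms $\log\alpha,\log\beta$ (any complex numbers with $e^{\log\alpha}=\alpha$, $e^{\log\beta}=\beta$). Let $S^1=\mathbb R/2\pi\mathbb Z$, let $S^3=\{(\xi_1,\xi_2)\in\mathbb C^2:|\xi_1|^2+|\xi_2|^2=1\}$, and let $$F_{\alpha,\beta}:S^1\times S^3\to H_{\alpha,\beta},\qquad F_{\alpha,\beta}(\theta,(\xi_1,\xi_2))=\bigl[e^{\theta\log\alpha/2\pi}\xi_1,\;e^{\theta\log\beta/2\pi}\xi_2\bigr].$$ Let $e_1,e_2,e_3,e_4$ be the frame of $S^1\times S^3$ given by $e_1=\partial_\theta$, $e_2=(i\xi_1,i\xi_2)$, $e_3=(-\bar\xi_2,\bar\xi_1)$, $e_4=(-i\bar\xi_2,i\bar\xi_1)$, and let $e^1=d\theta$ be the first form of the dual frame. Then $F_{\alpha,\beta}$ is a (well defined) diffeomorphism.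 Let $J_{\alpha,\beta}$ be the complex structure on $S^1\times S^3$ transferred from $H_{\alpha,\beta}$ by $F_{\alpha,\beta}$, so that $F_{\alpha,\beta}:(S^1\times S^3,J_{\alpha,\beta})\to H_{\alpha,\beta}$ is an isomorphism. At each point, $(e_2,e_3)$ is a complex basis of the tangent space with respect to $J_{\alpha,\beta}$. Let $h:\mathbb R\to\mathbb R$ be any smooth positive function with period $2\pi$, and put $\Re G=|\xi_1|^2\log|\alpha|+|\xi_2|^2\log|\beta|$. Let $g^h_{\alpha,\beta}$ be the real part of the Hermitian form (complex linear in its first argument) whose matrix in the complex basis $(e_2,e_3)$ at $(\theta,(\xi_1,\xi_2))$ is $$\begin{pmatrix} \dfrac{\pi h(\theta)}{(\Re G)^2}+\dfrac{|\xi_1|^2|\xi_2|^2\log^2(|\alpha|/|\beta|)}{(\Re G)^3} & \dfrac{i\xi_1\xi_2\log(|\alpha|/|\beta|)}{(\Re G)^2}\\[2ex] \dfrac{\overline{i\xi_1\xi_2}\,\log(|\alpha|/|\beta|)}{(\Re G)^2} & \dfrac1{\Re G} \end{pmatrix}.$$ Then $g^h_{\alpha,\beta}$ is a well defined Hermitian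 metric on $(S^1\times S^3,J_{\alpha,\beta})$, and it is locally conformal Kähler: $S^1\times S^3$ is covered by open sets $U$ carrying smooth functions $f:U\to\mathbb R$ such that $e^{-f}g^h_{\alpha,\beta}|_U$ is a Kähler metric. Its Lee form is $-h\,e^1$: for every open $U$ and every smooth $f:U\to\mathbb R$ such that $e^{-f}g^h_{\alpha,\beta}|_U$ is Kähler, one has $df=-h\,e^1$ on $U$. -/

import Mathlib

open scoped Manifold ContDiff Topology

noncomputable section

namespace HopfLCK

/-! ### Differential geometry on a manifold with an almost complex structure -/

section General

variable {E : Type*} [NormedAddCommGroup E] [NormedSpace ℝ E]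
  {H : Type*} [TopologicalSpace H] (I : ModelWithCorners ℝ E H)
  {M : Type*} [TopologicalSpace M] [ChartedSpace H M]

/-- A (not necessarily smooth) differential `k`-form on `M`. -/
abbrev DiffForm (M : Type*) [TopologicalSpace M] [ChartedSpace H M] (k : ℕ) : Type _ :=
  Π x : M, TangentSpace I x [⋀^Fin k]→L[ℝ] ℝ

/-- A field of endomorphisms of the tangent spaces. -/
abbrev EndField (M : Type*) [TopologicalSpace M] [ChartedSpace H M] : Type _ :=
  Π x : M, TangentSpace I x →L[ℝ] TangentSpace I x

/-- A field of bilinear forms on the tangent spaces. -/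
abbrev BilinField (M : Type*) [TopologicalSpace M] [ChartedSpace H M] : Type _ :=
  Π x : M, TangentSpace I x →L[ℝ] TangentSpace I x →L[ℝ] ℝ

variable {I}

/-- The expression of a form in the preferred chart at `x`: its pull-back to the model space. -/
def formInChart {k : ℕ} (η : DiffForm I M k) (x : M) : E → E [⋀^Fin k]→L[ℝ] ℝ := fun y =>
  (η ((extChartAt I x).symm y)).compContinuousLinearMap
    (mfderivWithin 𝓘(ℝ, E) I (extChartAt I x).symm (Set.range I) y)

/-- The exterior derivative of a form on `M`, computed at `x` in the preferred chart at `x`. -/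
def extD {k : ℕ} (η : DiffForm I M k) : DiffForm I M (k + 1) := fun x =>
  (extDerivWithin (formInChart η x) (Set.range I) (extChartAt I x x)).compContinuousLinearMap
    (mfderiv I 𝓘(ℝ, E) (extChartAt I x) x)

/-- `J` is an (integrable) complex structure of complex dimension two: around every point there are
`J`-holomorphic coordinates with values in `ℂ²`. -/
def IsComplexStructure (J : EndField I M) : Prop :=
  ∀ x : M, ∃ U : Set M, IsOpen U ∧ x ∈ U ∧ ∃ ζ : M → ℂ × ℂ,
    ContMDiffOn I 𝓘(ℝ, ℂ × ℂ) ∞ ζ U ∧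
    ∀ y ∈ U, Function.Bijective (mvfderiv I ζ y) ∧
      ∀ v : TangentSpace I y, mvfderiv I ζ y (J y v) = Complex.I • mvfderiv I ζ y v

variable [IsManifold I 1 M]

/-- The restriction of `g` to the open set `U` is a (smooth) Hermitian metric with respect to `J`:
a smooth Riemannian metric for which `J` is an isometry. -/
structure IsHermitianMetricOn (J : EndField I M) (g : BilinField I M) (U : Set M) : Prop where
  smooth : ContMDiffOn I (I.prod 𝓘(ℝ, E →L[ℝ] E →L[ℝ] ℝ)) ∞
    (fun x => Bundle.TotalSpace.mk' (E →L[ℝ] E →L[ℝ] ℝ)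
      (E := fun x : M => TangentSpace I x →L[ℝ] TangentSpace I x →L[ℝ] ℝ) x (g x)) U
  symm : ∀ x ∈ U, ∀ v w : TangentSpace I x, g x v w = g x w v
  pos : ∀ x ∈ U, ∀ v : TangentSpace I x, v ≠ 0 → 0 < g x v v
  isometry : ∀ x ∈ U, ∀ v w : TangentSpace I x, g x (J x v) (J x w) = g x v w

/-- The restriction of `g` to the open set `U` is a Kähler metric: it is Hermitian and its
fundamental form `Ω(X, Y) = g(J X, Y)` is closed. -/
def IsKahlerMetricOn (J : EndField I M) (g : BilinField I M) (U : Set M) : Prop :=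
  IsHermitianMetricOn J g U ∧
    ∃ Ω : DiffForm I M 2,
      (∀ x ∈ U, ∀ v : Fin 2 → TangentSpace I x, Ω x v = g x (J x (v 0)) (v 1)) ∧
      ∀ x ∈ U, extD Ω x = 0

/-- The local conformal change `e^{-f} g`. -/
def conformal (f : M → ℝ) (g : BilinField I M) : BilinField I M :=
  fun x => Real.exp (-f x) • g x

/-- `(M, J, g)` is a locally conformal Kähler manifold: `J` is a complex structure, `g` is
Hermitian, and `M` is covered by open sets `U` carrying smooth functions `f` such that
`e^{-f} g` is Kähler on `U`. -/
def IsLCK (J : EndField I M) (g : BilinField I M) : Prop :=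
  IsComplexStructure J ∧ IsHermitianMetricOn J g Set.univ ∧
    ∀ x : M, ∃ U : Set M, IsOpen U ∧ x ∈ U ∧ ∃ f : M → ℝ,
      ContMDiffOn I 𝓘(ℝ, ℝ) ∞ f U ∧ IsKahlerMetricOn J (conformal f g) U

/-- `η` is the Lee form of the locally conformal Kähler manifold `(M, J, g)`: whenever `e^{-f} g` is
Kähler on an open set `U`, one has `η = df` on `U`. -/
def IsLeeForm (J : EndField I M) (g : BilinField I M) (η : Π x : M, TangentSpace I x →L[ℝ] ℝ) :
    Prop :=
  ∀ (U : Set M) (f : M → ℝ), IsOpen U → ContMDiffOn I 𝓘(ℝ, ℝ) ∞ f U →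
    IsKahlerMetricOn J (conformal f g) U → ∀ x ∈ U, η x = mvfderiv I f x

end General

/-! ### Matrices of Hermitian forms in a complex basis -/

section LinearAlgebra

variable {T : Type*} [AddCommGroup T] [Module ℝ T] [TopologicalSpace T]

/-- The complex linear combination `c₀ u + c₁ v`, where `i` acts on `T` by `J`. -/
def complexComb (J : T →L[ℝ] T) (u v : T) (c : Fin 2 → ℂ) : T :=
  (c 0).re • u + (c 0).im • J u + (c 1).re • v + (c 1).im • J v

/-- `(u, v)` is a basis of the complex vector space `(T, J)`. -/
def IsComplexBasis (J : T →L[ℝ] T) (u v : T) : Prop :=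
  Function.Bijective (complexComb J u v)

/-- The real bilinear form `g` is the real part of the Hermitian form (complex linear in the first
variable) which is given by the matrix `A` in the complex basis `(u, v)` of `(T, J)`. -/
def HasComplexMatrix (J : T →L[ℝ] T) (u v : T) (A : Matrix (Fin 2) (Fin 2) ℂ)
    (g : T →L[ℝ] T →L[ℝ] ℝ) : Prop :=
  ∀ c d : Fin 2 → ℂ, g (complexComb J u v c) (complexComb J u v d) =
    (∑ i, ∑ j, c i * A i j * (starRingEnd ℂ) (d j)).re

end LinearAlgebra

/-! ### The Hopf surface -/

/-- The parameters of a primary Hopf surface of class one: `|α| ≥ |β| > 1`. -/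
structure HopfPair where
  α : ℂ
  β : ℂ
  one_lt : 1 < ‖β‖
  le : ‖β‖ ≤ ‖α‖

lemma HopfPair.α_ne (P : HopfPair) : P.α ≠ 0 :=
  norm_pos_iff.1 (by linarith [P.one_lt, P.le])

lemma HopfPair.β_ne (P : HopfPair) : P.β ≠ 0 :=
  norm_pos_iff.1 (by linarith [P.one_lt])

/-- `ℂ² ∖ 0` as an open subset of `ℂ²`. -/
def puncturedOpens : TopologicalSpace.Opens (ℂ × ℂ) := ⟨{0}ᶜ, isOpen_compl_singleton⟩

/-- `ℂ² ∖ 0`, which carries the action of `ℤ` by `n ↦ fⁿ`, where `f(z₁, z₂) = (α z₁, β z₂)`. -/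
def Punctured (_P : HopfPair) : Type := puncturedOpens

namespace Punctured

variable (P : HopfPair)

instance : TopologicalSpace (Punctured P) := inferInstanceAs (TopologicalSpace puncturedOpens)
instance : T2Space (Punctured P) := inferInstanceAs (T2Space puncturedOpens)
instance : LocallyCompactSpace (Punctured P) :=
  puncturedOpens.isOpen.isOpenEmbedding_subtypeVal.locallyCompactSpace
instance : ChartedSpace (ℂ × ℂ) (Punctured P) :=
  inferInstanceAs (ChartedSpace (ℂ × ℂ) puncturedOpens)

variable {P}

/-- The point of `ℂ² ∖ 0` with the given coordinates. -/
def mk (z : ℂ × ℂ) (hz : z ≠ 0) : Punctured P := ⟨z, hz⟩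

/-- The coordinates of a point of `ℂ² ∖ 0`. -/
def val (z : Punctured P) : ℂ × ℂ := Subtype.val z

lemma val_ne (z : Punctured P) : z.val ≠ 0 := Subtype.property z

lemma ext {z w : Punctured P} (h : z.val = w.val) : z = w := Subtype.ext h

lemma continuous_val : Continuous (val : Punctured P → ℂ × ℂ) := continuous_subtype_val

instance : AddAction ℤ (Punctured P) where
  vadd n z := mk (P.α ^ n * z.val.1, P.β ^ n * z.val.2) (fun h => z.val_ne (by
    have h1 := congrArg Prod.fst h
    have h2 := congrArg Prod.snd h
    simp only [Prod.fst_zero, Prod.snd_zero, mul_eq_zero, zpow_ne_zero n P.α_ne,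
      zpow_ne_zero n P.β_ne, false_or] at h1 h2
    exact Prod.ext h1 h2))
  zero_vadd z := ext (Prod.ext (by change P.α ^ (0 : ℤ) * _ = _; simp)
    (by change P.β ^ (0 : ℤ) * _ = _; simp))
  add_vadd m n z := ext (Prod.ext
    (by change P.α ^ (m + n) * _ = P.α ^ m * (P.α ^ n * _); rw [zpow_add₀ P.α_ne, mul_assoc])
    (by change P.β ^ (m + n) * _ = P.β ^ m * (P.β ^ n * _); rw [zpow_add₀ P.β_ne, mul_assoc]))

lemma vadd_val (n : ℤ) (z : Punctured P) :
    (n +ᵥ z).val = (P.α ^ n * z.val.1, P.β ^ n * z.val.2) := rfl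

instance : ContinuousConstVAdd ℤ (Punctured P) where
  continuous_const_vadd n := by
    refine Continuous.subtype_mk (f := fun z : Punctured P =>
      (P.α ^ n * z.val.1, P.β ^ n * z.val.2)) ?_ _
    have := continuous_val (P := P)
    fun_prop

lemma norm_vadd (n : ℕ) (z : Punctured P) : ‖P.β‖ ^ n * ‖z.val‖ ≤ ‖((n : ℤ) +ᵥ z).val‖ := by
  rw [vadd_val, Prod.norm_def, Prod.norm_def, mul_max_of_nonneg _ _ (by positivity)]
  simp only [zpow_natCast, norm_mul, norm_pow]
  gcongr
  exact P.le

lemma norm_vadd_natAbs (n : ℤ) (z : Punctured P) :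
    ‖P.β‖ ^ n.natAbs * min ‖z.val‖ ‖(n +ᵥ z).val‖ ≤ max ‖z.val‖ ‖(n +ᵥ z).val‖ := by
  rcases Int.natAbs_eq n with h | h
  · have := norm_vadd n.natAbs z
    rw [← h] at this
    exact (mul_le_mul_of_nonneg_left (min_le_left _ _) (by positivity)).trans
      (this.trans (le_max_right _ _))
  · have := norm_vadd n.natAbs (n +ᵥ z)
    rw [vadd_vadd, show ((n.natAbs : ℤ) + n) = 0 by omega, zero_vadd] at this
    exact (mul_le_mul_of_nonneg_left (min_le_right _ _) (by positivity)).trans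
      (this.trans (le_max_left _ _))

lemma norm_bounds {K : Set (Punctured P)} (hK : IsCompact K) :
    ∃ r > 0, ∃ R, ∀ z ∈ K, r ≤ ‖z.val‖ ∧ ‖z.val‖ ≤ R := by
  rcases K.eq_empty_or_nonempty with rfl | hne
  · exact ⟨1, one_pos, 0, by simp⟩
  have hc : ContinuousOn (fun z : Punctured P => ‖z.val‖) K :=
    (continuous_norm.comp continuous_val).continuousOn
  obtain ⟨x, -, hx⟩ := hK.exists_isMinOn hne hc
  obtain ⟨y, -, hy⟩ := hK.exists_isMaxOn hne hc
  exact ⟨‖x.val‖, norm_pos_iff.2 x.val_ne, ‖y.val‖, fun z hz => ⟨hx hz, hy hz⟩⟩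

instance : ProperlyDiscontinuousVAdd ℤ (Punctured P) where
  finite_disjoint_inter_image := by
    intro K L hK hL
    obtain ⟨r, hr, R, hK'⟩ := norm_bounds hK
    obtain ⟨s, hs, S, hL'⟩ := norm_bounds hL
    obtain ⟨N, hN⟩ := pow_unbounded_of_one_lt (max R S / min r s) P.one_lt
    refine (Set.finite_Icc (-(N : ℤ)) N).subset ?_
    rintro n ⟨_, ⟨z, hz, rfl⟩, hw⟩
    have hmin : 0 < min r s := lt_min hr hs
    have h1 := norm_vadd_natAbs n z
    have h2 : ‖P.β‖ ^ n.natAbs * min r s ≤ max R S :=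
      (mul_le_mul_of_nonneg_left (min_le_min (hK' z hz).1 (hL' _ hw).1) (by positivity)).trans
        (h1.trans (max_le_max (hK' z hz).2 (hL' _ hw).2))
    have h3 : ‖P.β‖ ^ n.natAbs < ‖P.β‖ ^ N := ((le_div_iff₀ hmin).2 h2).trans_lt hN
    have h4 := (pow_lt_pow_iff_right₀ P.one_lt).1 h3
    simp only [Set.mem_Icc]
    omega

instance : IsCancelVAdd ℤ (Punctured P) where
  left_cancel' n z w h := by simpa using h
  right_cancel' m n z h := by
    have h0 : ((m - n) +ᵥ z) = z := by
      rw [sub_eq_neg_add, add_vadd]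
      change -n +ᵥ (m +ᵥ z) = z
      rw [show m +ᵥ z = n +ᵥ z from h, neg_vadd_vadd]
    have h1 := norm_vadd_natAbs (m - n) z
    rw [h0, min_self, max_self] at h1
    have hz : 0 < ‖z.val‖ := norm_pos_iff.2 z.val_ne
    have h2 : ‖P.β‖ ^ (m - n).natAbs ≤ 1 := by
      by_contra hcon
      push Not at hcon
      nlinarith
    by_contra hne
    have : 1 < ‖P.β‖ ^ (m - n).natAbs := one_lt_pow₀ P.one_lt (by omega)
    linarith

end Punctured

/-- The Hopf surface `H_{α,β} = (ℂ² ∖ 0) / ⟨f⟩`, `f(z₁, z₂) = (α z₁, β z₂)`. Its atlas is the one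
given by the local inverses of the covering `ℂ² ∖ 0 → H_{α,β}`. -/
abbrev HopfSurface (P : HopfPair) : Type := AddAction.orbitRel.Quotient ℤ (Punctured P)

/-- The class `[z₁, z₂]` in `H_{α,β}` of `(z₁, z₂) ∈ ℂ² ∖ 0`. -/
def HopfSurface.mk {P : HopfPair} (z : Punctured P) : HopfSurface P := Quotient.mk _ z

lemma HopfSurface.mk_eq_mk {P : HopfPair} {z w : Punctured P} :
    HopfSurface.mk z = HopfSurface.mk w ↔ ∃ n : ℤ, n +ᵥ w = z := by
  rw [HopfSurface.mk, HopfSurface.mk, Quotient.eq]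
  exact Iff.rfl


lemma HopfSurface.proj_isLocalHomeomorph (P : HopfPair) :
    IsLocalHomeomorph (HopfSurface.mk (P := P)) :=
  (isAddQuotientCoveringMap_quotientMk_of_properlyDiscontinuousVAdd
    (G := ℤ) (E := Punctured P)).isCoveringMap.isLocalHomeomorph

lemma Punctured.chartAt_apply {P : HopfPair} (z w : Punctured P) :
    chartAt (ℂ × ℂ) z w = w.val := rfl

lemma Punctured.chartAt_source {P : HopfPair} (z : Punctured P) :
    (chartAt (ℂ × ℂ) z).source = Set.univ := by
  change ((OpenPartialHomeomorph.refl (ℂ × ℂ)).subtypeRestr _).source = _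
  rw [OpenPartialHomeomorph.subtypeRestr_source]
  rfl

lemma HopfSurface.contDiffOn_transition (P : HopfPair) (z z' : Punctured P) :
    let L := (HopfSurface.proj_isLocalHomeomorph P).localInverseAt
    let e := (L (x := z)).trans (chartAt (ℂ × ℂ) z)
    let e' := (L (x := z')).trans (chartAt (ℂ × ℂ) z')
    ContDiffOn ℂ ω (e.symm ≫ₕ e') (e.symm ≫ₕ e').source := by
  intro L e e' y₀ hy₀
  set c := chartAt (ℂ × ℂ) z with hc
  have hval : ∀ y ∈ c.target, (c.symm y).val = y := fun y hy => c.right_inv hy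
  have hy₁ : y₀ ∈ c.target := by
    have := hy₀
    simp only [e, mfld_simps] at this
    exact this.1.1
  have hy₂ : HopfSurface.mk (c.symm y₀) ∈ (L (x := z')).source := by
    have := hy₀
    simp only [e, e', L, mfld_simps] at this
    rw [IsLocalHomeomorph.localInverseAt_symm] at this
    exact this.2.1
  have hmk : HopfSurface.mk (L (x := z') (HopfSurface.mk (c.symm y₀))) =
      HopfSurface.mk (c.symm y₀) :=
    (HopfSurface.proj_isLocalHomeomorph P).apply_localInverseAt_of_mem hy₂
  obtain ⟨n, hn⟩ := HopfSurface.mk_eq_mk.1 hmk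
  have hcont : ContinuousAt (fun y => n +ᵥ c.symm y) y₀ :=
    (continuous_const_vadd n).continuousAt.comp (c.continuousAt_symm hy₁)
  have hev : ∀ᶠ y in 𝓝 y₀, n +ᵥ c.symm y ∈ (L (x := z')).target :=
    hcont.preimage_mem_nhds ((L (x := z')).open_target.mem_nhds
      (by rw [hn]; exact (L (x := z')).map_source hy₂))
  have hev' : ∀ᶠ y in 𝓝 y₀, y ∈ c.target := c.open_target.mem_nhds hy₁
  have heq : (e.symm ≫ₕ e' : ℂ × ℂ → ℂ × ℂ) =ᶠ[𝓝 y₀]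
      fun y => (P.α ^ n * y.1, P.β ^ n * y.2) := by
    filter_upwards [hev, hev'] with y h1 h2
    have h3 : L (x := z') (HopfSurface.mk (c.symm y)) = n +ᵥ c.symm y := by
      have h4 := (L (x := z')).right_inv h1
      rw [(HopfSurface.proj_isLocalHomeomorph P).localInverseAt_symm] at h4
      rw [← h4]
      congr 1
      exact (HopfSurface.mk_eq_mk.2 ⟨n, rfl⟩).symm
    have h5 : (e.symm ≫ₕ e' : ℂ × ℂ → ℂ × ℂ) y =
        (L (x := z') (HopfSurface.mk (c.symm y))).val := by
      simp only [e, e', L, mfld_simps, Punctured.chartAt_apply]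
      rw [IsLocalHomeomorph.localInverseAt_symm]
    rw [h5, h3, Punctured.vadd_val, hval y h2]
  have hsm : ContDiff ℂ ω (fun y : ℂ × ℂ => (P.α ^ n * y.1, P.β ^ n * y.2)) := by fun_prop
  exact (hsm.contDiffAt.congr_of_eventuallyEq heq).contDiffWithinAt

/-- The changes of charts of `H_{α,β}` are holomorphic: `H_{α,β}` is a complex surface. -/
instance (P : HopfPair) : IsManifold 𝓘(ℂ, ℂ × ℂ) ω (HopfSurface P) := by
  apply isManifold_of_contDiffOn
  rintro e e' ⟨q, rfl⟩ ⟨q', rfl⟩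
  simp only [modelWithCornersSelf_coe, modelWithCornersSelf_coe_symm, Function.comp_id,
    Function.id_comp, Set.range_id, Set.inter_univ, Set.preimage_id]
  exact HopfSurface.contDiffOn_transition P _ _

/-! ### The manifold `S¹ × S³` and its parallelization -/

/-- The unit sphere of `ℝ⁴ = ℂ²`. -/
abbrev S3 : Type := Metric.sphere (0 : EuclideanSpace ℝ (Fin 4)) 1

/-- `S¹ × S³`, where `θ ∈ ℝ / 2πℤ` is identified with `e^{iθ}`. -/
abbrev S1S3 : Type := Circle × S3

/-- The model with corners of the manifold `S¹ × S³`. -/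
abbrev IS : ModelWithCorners ℝ (EuclideanSpace ℝ (Fin 1) × EuclideanSpace ℝ (Fin 3))
    (ModelProd (EuclideanSpace ℝ (Fin 1)) (EuclideanSpace ℝ (Fin 3))) := (𝓡 1).prod (𝓡 3)

/-- The first complex coordinate of a point of `S³ ⊆ ℂ²`. -/
def xi1 (Q : S3) : ℂ := ⟨Q.1 0, Q.1 1⟩

/-- The second complex coordinate of a point of `S³ ⊆ ℂ²`. -/
def xi2 (Q : S3) : ℂ := ⟨Q.1 2, Q.1 3⟩

/-- The inclusion of `S¹ × S³` in `ℂ × ℝ⁴`. -/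
def incl (p : S1S3) : ℂ × EuclideanSpace ℝ (Fin 4) := (p.1, p.2)

/-- The vectors `i e^{iθ}`, `iQ`, `jQ`, `kQ` of the ambient space `ℂ × ℝ⁴`, where
`iQ = (i ξ₁, i ξ₂)`, `jQ = (-conj ξ₂, conj ξ₁)` and `kQ = (-i conj ξ₂, i conj ξ₁)`. -/
def frameVec (p : S1S3) : Fin 4 → ℂ × EuclideanSpace ℝ (Fin 4) :=
  ![(Complex.I * p.1, 0),
    (0, !₂[-p.2.1 1, p.2.1 0, -p.2.1 3, p.2.1 2]),
    (0, !₂[-p.2.1 2, p.2.1 3, p.2.1 0, -p.2.1 1]),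
    (0, !₂[-p.2.1 3, -p.2.1 2, p.2.1 1, p.2.1 0])]

lemma S3_sum_sq (Q : S3) : Q.1 0 ^ 2 + Q.1 1 ^ 2 + Q.1 2 ^ 2 + Q.1 3 ^ 2 = 1 := by
  have h : ‖Q.1‖ = 1 := by simp
  have h2 := EuclideanSpace.real_norm_sq_eq Q.1
  rw [h, Fin.sum_univ_four] at h2
  linarith

lemma linearIndependent_frameVec (p : S1S3) : LinearIndependent ℝ (frameVec p) := by
  rw [Fintype.linearIndependent_iff]
  intro c hc
  have hQ := S3_sum_sq p.2
  rw [Fin.sum_univ_four] at hc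
  have h1 := congrArg Prod.fst hc
  have h2 := fun i : Fin 4 => congrArg (fun z : ℂ × EuclideanSpace ℝ (Fin 4) => z.2 i) hc
  have e0 := h2 0
  have e1 := h2 1
  have e2 := h2 2
  have e3 := h2 3
  simp [frameVec] at h1 e0 e1 e2 e3
  generalize p.2.1 0 = x at *
  generalize p.2.1 1 = y at *
  generalize p.2.1 2 = z at *
  generalize p.2.1 3 = t at *
  have c1 : c 1 = 0 := by
    linear_combination (-c 1) * hQ - y * e0 + x * e1 - t * e2 + z * e3
  have c2 : c 2 = 0 := by
    linear_combination (-c 2) * hQ - z * e0 + t * e1 + x * e2 - y * e3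
  have c3 : c 3 = 0 := by
    linear_combination (-c 3) * hQ - t * e0 - z * e1 + y * e2 + x * e3
  intro i
  fin_cases i
  · exact h1
  · exact c1
  · exact c2
  · exact c3

lemma mvfderiv_incl (p : S1S3) (v : TangentSpace (𝓡 1) p.1) (w : TangentSpace (𝓡 3) p.2) :
    mvfderiv IS incl p ((v, w) : TangentSpace (𝓡 1) p.1 × TangentSpace (𝓡 3) p.2) =
      (mvfderiv (𝓡 1) (fun z : Circle => (z : ℂ)) p.1 v,
        mvfderiv (𝓡 3) (fun Q : S3 => Q.1) p.2 w) := by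
  have h1 : MDifferentiableAt (𝓡 1) 𝓘(ℝ, ℂ) (fun z : Circle => (z : ℂ)) p.1 := by
    have : Fact (Module.finrank ℝ ℂ = 1 + 1) := finrank_real_complex_fact'
    exact (contMDiff_coe_sphere (E := ℂ) (n := 1) (m := 1) p.1).mdifferentiableAt one_ne_zero
  have h2 : MDifferentiableAt (𝓡 3) 𝓘(ℝ, EuclideanSpace ℝ (Fin 4)) (fun Q : S3 => Q.1) p.2 := by
    have : Fact (Module.finrank ℝ (EuclideanSpace ℝ (Fin 4)) = 3 + 1) := ⟨by simp⟩
    exact (contMDiff_coe_sphere (n := 3) (m := 1) p.2).mdifferentiableAt one_ne_zero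
  have h := mfderiv_prodMap (p := p) h1 h2
  have h' := DFunLike.congr_fun h
    ((v, w) : TangentSpace (𝓡 1) p.1 × TangentSpace (𝓡 3) p.2)
  rw [← modelWithCornersSelf_prod, chartedSpaceSelf_prod] at h'
  exact h'

/-- The four vectors `frameVec p` are the images under the differential of the inclusion of a basis
of the tangent space of `S¹ × S³` at `p`. -/
theorem exists_frame (p : S1S3) :
    ∃ e : Module.Basis (Fin 4) ℝ (TangentSpace IS p),
      ∀ k, mvfderiv IS incl p (e k) = frameVec p k := by
  have hQ := S3_sum_sq p.2
  have h1 : ∃ v, mvfderiv (𝓡 1) (fun z : Circle => (z : ℂ)) p.1 v = Complex.I * p.1 := by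
    have : Fact (Module.finrank ℝ ℂ = 1 + 1) := finrank_real_complex_fact'
    have := range_mvfderiv_subtypeVal (E := ℂ) (n := 1) p.1
    have hm : Complex.I * (p.1 : ℂ) ∈ (Submodule.span ℝ {(p.1 : ℂ)})ᗮ := by
      rw [Submodule.mem_orthogonal_singleton_iff_inner_right, Complex.inner]
      simp
      ring
    exact (this ▸ hm :)
  have h2 : ∀ u : EuclideanSpace ℝ (Fin 4), inner ℝ (p.2 : EuclideanSpace ℝ (Fin 4)) u = 0 →
      ∃ w, mvfderiv (𝓡 3) (fun Q : S3 => Q.1) p.2 w = u := by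
    intro u hu
    have : Fact (Module.finrank ℝ (EuclideanSpace ℝ (Fin 4)) = 3 + 1) := ⟨by simp⟩
    have := range_mvfderiv_subtypeVal (n := 3) p.2
    rw [← Submodule.mem_orthogonal_singleton_iff_inner_right, ← this] at hu
    exact hu
  have h3 : ∀ k, ∃ v : TangentSpace IS p, mvfderiv IS incl p v = frameVec p k := by
    have key : ∀ u : EuclideanSpace ℝ (Fin 4),
        inner ℝ (p.2 : EuclideanSpace ℝ (Fin 4)) u = 0 →
        ∃ v : TangentSpace IS p, mvfderiv IS incl p v = (0, u) := by
      intro u hu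
      obtain ⟨w, hw⟩ := h2 u hu
      exact ⟨_, (mvfderiv_incl p 0 w).trans (by rw [hw, map_zero])⟩
    intro k
    fin_cases k
    · obtain ⟨v, hv⟩ := h1
      exact ⟨_, (mvfderiv_incl p v 0).trans (by rw [hv, map_zero]; rfl)⟩
    all_goals
      refine key _ ?_
      rw [PiLp.inner_apply, Fin.sum_univ_four]
      simp
      ring
  choose e he using h3
  have hli : LinearIndependent ℝ e := by
    apply LinearIndependent.of_comp (mvfderiv IS incl p).toLinearMap
    have : (mvfderiv IS incl p).toLinearMap ∘ e = frameVec p := funext he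
    rw [this]
    exact linearIndependent_frameVec p
  have hfin : Module.finrank ℝ (TangentSpace IS p) = 4 := by
    change Module.finrank ℝ (EuclideanSpace ℝ (Fin 1) × EuclideanSpace ℝ (Fin 3)) = 4
    rw [Module.finrank_prod]
    simp
  refine ⟨basisOfLinearIndependentOfCardEqFinrank hli (by simp [hfin]), fun k => ?_⟩
  rw [coe_basisOfLinearIndependentOfCardEqFinrank]
  exact he k

/-- The parallelization `(e₁, e₂, e₃, e₄)` of `S¹ × S³`, here numbered from `0` to `3`. -/
def frame (p : S1S3) : Module.Basis (Fin 4) ℝ (TangentSpace IS p) := (exists_frame p).choose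

/-- The frame is characterized by its image in the ambient space. -/
theorem mvfderiv_incl_frame (p : S1S3) (k : Fin 4) :
    mvfderiv IS incl p (frame p k) = frameVec p k := (exists_frame p).choose_spec k

/-- The one-form `e¹ = dθ` of the dual frame. -/
def coframeOne (p : S1S3) : TangentSpace IS p →L[ℝ] ℝ :=
  haveI : T2Space (TangentSpace IS p) :=
    inferInstanceAs (T2Space (EuclideanSpace ℝ (Fin 1) × EuclideanSpace ℝ (Fin 3)))
  haveI : FiniteDimensional ℝ (TangentSpace IS p) := (frame p).finiteDimensional_of_finite
  LinearMap.toContinuousLinearMap ((frame p).coord 0)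

/-! ### The diffeomorphism, the complex structure and the metric -/

lemma lift_ne (a b : ℂ) (θ : ℝ) (Q : S3) : (Complex.exp (θ * a / (2 * Real.pi)) * xi1 Q,
    Complex.exp (θ * b / (2 * Real.pi)) * xi2 Q) ≠ (0 : ℂ × ℂ) := by
  intro h
  have h1 := congrArg Prod.fst h
  have h2 := congrArg Prod.snd h
  simp only [Prod.fst_zero, Prod.snd_zero, mul_eq_zero, Complex.exp_ne_zero, false_or] at h1 h2
  have hQ := S3_sum_sq Q
  have e0 : Q.1 0 = 0 := congrArg Complex.re h1
  have e1 : Q.1 1 = 0 := congrArg Complex.im h1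
  have e2 : Q.1 2 = 0 := congrArg Complex.re h2
  have e3 : Q.1 3 = 0 := congrArg Complex.im h2
  simp [e0, e1, e2, e3] at hQ

/-- The lift `(θ, (ξ₁, ξ₂)) ↦ (e^{θ a / 2π} ξ₁, e^{θ b / 2π} ξ₂)`, where `a = log α` and
`b = log β`. -/
def hopfLift (P : HopfPair) (a b : ℂ) (θ : ℝ) (Q : S3) : Punctured P :=
  Punctured.mk (Complex.exp (θ * a / (2 * Real.pi)) * xi1 Q,
    Complex.exp (θ * b / (2 * Real.pi)) * xi2 Q) (lift_ne a b θ Q)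

/-- The map `F_{α,β} : S¹ × S³ → H_{α,β}` induced by the lift; as `exp a = α` and `exp b = β`, any
argument `θ` of the point of `S¹` may be used. -/
def hopfMap (P : HopfPair) (a b : ℂ) (p : S1S3) : HopfSurface P :=
  HopfSurface.mk (hopfLift P a b (Complex.arg p.1) p.2)

/-- Multiplication by `i` in the tangent spaces of the complex surface `H_{α,β}`. -/
def hopfI (P : HopfPair) : EndField 𝓘(ℝ, ℂ × ℂ) (HopfSurface P) := fun _ =>
  (Complex.I • ContinuousLinearMap.id ℝ (ℂ × ℂ) : (ℂ × ℂ) →L[ℝ] (ℂ × ℂ))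

/-- The complex structure `J_{α,β}` of `S¹ × S³`, transferred from `H_{α,β}` by `F_{α,β}`. -/
def hopfJ (P : HopfPair) (a b : ℂ) : EndField IS S1S3 := fun p =>
  (mfderiv IS 𝓘(ℝ, ℂ × ℂ) (hopfMap P a b) p).inverse ∘L hopfI P (hopfMap P a b p) ∘L
    mfderiv IS 𝓘(ℝ, ℂ × ℂ) (hopfMap P a b) p

/-- The real part `|ξ₁|² log |α| + |ξ₂|² log |β|` of the function `G`. -/
def reG (P : HopfPair) (Q : S3) : ℝ :=
  ‖xi1 Q‖ ^ 2 * Real.log ‖P.α‖ + ‖xi2 Q‖ ^ 2 * Real.log ‖P.β‖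

/-- The Hermitian matrix which defines the metric `g^h_{α,β}`; `t` is the value of `h`. -/
def hopfMatrix (P : HopfPair) (t : ℝ) (Q : S3) : Matrix (Fin 2) (Fin 2) ℂ :=
  let L : ℝ := Real.log (‖P.α‖ / ‖P.β‖)
  !![((Real.pi * t / reG P Q ^ 2 + ‖xi1 Q‖ ^ 2 * ‖xi2 Q‖ ^ 2 * L ^ 2 / reG P Q ^ 3 : ℝ) : ℂ),
      Complex.I * xi1 Q * xi2 Q * L / reG P Q ^ 2;
    (starRingEnd ℂ) (Complex.I * xi1 Q * xi2 Q) * L / reG P Q ^ 2,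
      1 / reG P Q]

/-- `g` is the metric `g^h_{α,β}`: at `(θ, Q)` it is given by the matrix `hopfMatrix P (h θ) Q` in
the complex basis `(e₂, e₃)`, for every `θ ∈ ℝ`. -/
def IsHopfMetric (P : HopfPair) (a b : ℂ) (h : ℝ → ℝ) (g : BilinField IS S1S3) : Prop :=
  ∀ (θ : ℝ) (Q : S3),
    HasComplexMatrix (hopfJ P a b (Circle.exp θ, Q)) (frame (Circle.exp θ, Q) 1)
      (frame (Circle.exp θ, Q) 2) (hopfMatrix P (h θ) Q) (g (Circle.exp θ, Q))

/-- `η` is the one-form `-h e¹`. -/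
def IsNegHCoframe (h : ℝ → ℝ) (η : Π p : S1S3, TangentSpace IS p →L[ℝ] ℝ) : Prop :=
  ∀ (θ : ℝ) (Q : S3), η (Circle.exp θ, Q) = -h θ • coframeOne (Circle.exp θ, Q)

end HopfLCK

end

open HopfLCK

open scoped Manifold ContDiff Topology

noncomputable section

namespace HopfLCK

/-! ### The exterior derivative of forms on manifolds without boundary -/

section ExteriorDerivative

/-! On `ℝ × S³` the lift `(θ, ξ) ↦ (e^{θa/2π} ξ₁, e^{θb/2π} ξ₂)` turns the shift of `θ` by `2π` into
the generator of the deck group. As `Re a` and `Re b` are positive, every orbit of this flow on `ℂ²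
∖ 0` crosses the unit sphere exactly once (`hopfLift_inj`, `exists_hopfLift_eq`), so the induced map
on `S¹ × S³` is bijective. Its differentials are bijective as well, and it is a diffeomorphism.

Expanding the differential of the lift in the unitary basis `(iξ₁, iξ₂)`, `(-conj ξ₂, conj ξ₁)` of
`ℂ²` gives the complex coordinates of a tangent vector in the basis `(e₂, e₃)`: `c₀ = e² - iC e¹`
and `c₁ = e³ + i e⁴ + D e¹`, with `C = G/2π` and `D = (b - a) ξ₁ξ₂/2π` (`mvfderiv_localLift`). The
complex structure multiplies them by `i` (`complexCoord_hopfJ`), so everything becomes explicit in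
the frame.

Over an arc of the circle choose a branch of `θ`, a primitive `η` of `h`, and put `f = -η(θ)`. The
fundamental form of `e^{-f} g` is the differential of `σ = e^η (Im C · e¹ + e²) / (2 Re G)`, hence
closed (`hopfForm_complexCoord_eq`, `localForm_apply`). The choice of `σ` is natural: it equals `-dΨ
∘ J` for a function `Ψ` of `θ` with `Ψ' = e^η/4π`, so that `Ψ` is, up to normalization, a Kähler
potential. The proof works with `σ` directly. Clearly `df = -h e¹`.

Any other factor making `g` Kähler has the same differential: two proportional closed fundamental
forms force `dφ ∧ Ω = 0` for their ratio `φ`, and in real dimension four this gives `dφ = 0`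
(`eq_zero_of_wedge_eq_zero`).

All forms are restrictions of forms on the ambient space `ℂ × ℝ⁴`, where the coframe depends
linearly on the base point. Exterior derivatives are computed there and pulled back
(`extD_pullbackForm`). -/

lemma two_le_infty : (2 : ℕ∞ω) ≤ ∞ :=
  WithTop.coe_le_coe.2 (le_top : (2 : ℕ∞) ≤ ⊤)

variable {E : Type*} [NormedAddCommGroup E] [NormedSpace ℝ E]
  {H : Type*} [TopologicalSpace H] {I : ModelWithCorners ℝ E H}
  {M : Type*} [TopologicalSpace M] [ChartedSpace H M]
  {V : Type*} [NormedAddCommGroup V] [NormedSpace ℝ V] {k : ℕ}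

/-- The pull-back of a form on a vector space under a map `G` defined on a manifold. -/
def pullbackForm (I : ModelWithCorners ℝ E H) (G : M → V) (τ : V → V [⋀^Fin k]→L[ℝ] ℝ) :
    DiffForm I M k :=
  fun x => (τ (G x)).compContinuousLinearMap (mvfderiv I G x)

lemma pullbackForm_apply (G : M → V) (τ : V → V [⋀^Fin k]→L[ℝ] ℝ) (x : M)
    (v : Fin k → TangentSpace I x) :
    pullbackForm I G τ x v = τ (G x) (fun i => mvfderiv I G x (v i)) := rfl

variable [I.Boundaryless]

lemma extD_congr {η η' : DiffForm I M k} {x : M} (h : ∀ᶠ y in 𝓝 x, η y = η' y) :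
    extD η x = extD η' x := by
  have h1 : formInChart η x =ᶠ[𝓝 (extChartAt I x x)] formInChart η' x := by
    have hc := continuousAt_extChartAt_symm (I := I) x
    rw [ContinuousAt, extChartAt_to_inv] at hc
    filter_upwards [hc.eventually h] with y hy
    simp only [formInChart, hy]
  unfold extD
  rw [I.range_eq_univ, extDerivWithin_univ, extDerivWithin_univ, h1.extDeriv_eq]

variable [IsManifold I ∞ M]

/-- The tangent space at `x` is modelled through the preferred chart at `x`, so the differential of
that chart at `x` is the identity and drops out of `extD`. -/
lemma extD_apply (η : DiffForm I M k) (x : M) (v : Fin (k + 1) → E) :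
    extD η x v = extDeriv (formInChart η x) (extChartAt I x x) v := by
  have hM : IsManifold I 1 M := .of_le (n := ∞) (by simp)
  unfold extD
  rw [I.range_eq_univ, extDerivWithin_univ, mfderiv_extChartAt_self]
  rfl

omit [I.Boundaryless] in
lemma formInChart_self (η : DiffForm I M k) (x : M) (v : Fin k → E) :
    formInChart η x (extChartAt I x x) v = η x v := by
  have hM : IsManifold I 1 M := .of_le (n := ∞) (by simp)
  unfold formInChart
  rw [mfderivWithin_range_extChartAt_symm]
  have : ∀ y, y = x → (η y).toFun v = (η x).toFun v := by rintro y rfl; rfl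
  exact this _ (extChartAt_to_inv x)

omit [IsManifold I ∞ M] in
lemma contDiffAt_comp_extChartAt_symm {F : Type*} [NormedAddCommGroup F] [NormedSpace ℝ F]
    {n : ℕ∞ω} {G : M → F} {x : M} (hG : ContMDiffAt I 𝓘(ℝ, F) n G x) :
    ContDiffAt ℝ n (G ∘ (extChartAt I x).symm) (extChartAt I x x) := by
  have := (contMDiffAt_iff.1 hG).2
  rwa [I.range_eq_univ, contDiffWithinAt_univ] at this

omit [IsManifold I ∞ M] in
lemma mvfderiv_eq_fderiv_comp {F : Type*} [NormedAddCommGroup F] [NormedSpace ℝ F]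
    {G : M → F} {x : M} (hG : ContMDiffAt I 𝓘(ℝ, F) 1 G x) (v : E) :
    mvfderiv I G x v = fderiv ℝ (G ∘ (extChartAt I x).symm) (extChartAt I x x) v := by
  rw [(hG.mdifferentiableAt one_ne_zero).mvfderiv, I.range_eq_univ, fderivWithin_univ]
  rfl

lemma mvfderiv_mfderivWithin_extChartAt_symm {F : Type*} [NormedAddCommGroup F] [NormedSpace ℝ F]
    {G : M → F} {x : M} {y : E} (hy : y ∈ (extChartAt I x).target)
    (hG : ContMDiffAt I 𝓘(ℝ, F) 1 G ((extChartAt I x).symm y)) (v : E) :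
    mvfderiv I G ((extChartAt I x).symm y)
      (mfderivWithin 𝓘(ℝ, E) I (extChartAt I x).symm (Set.range I) y v) =
    fderiv ℝ (G ∘ (extChartAt I x).symm) y v := by
  have hM : IsManifold I 1 M := .of_le (n := ∞) (by simp)
  have h1 : MDifferentiableWithinAt 𝓘(ℝ, E) I (extChartAt I x).symm (Set.range I) y :=
    mdifferentiableWithinAt_extChartAt_symm hy
  rw [I.range_eq_univ, mdifferentiableWithinAt_univ] at h1
  have h3 := mfderiv_comp_apply y (hG.mdifferentiableAt one_ne_zero) h1 v
  rw [mfderiv_eq_fderiv] at h3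
  rw [I.range_eq_univ, mfderivWithin_univ]
  exact h3.symm

lemma formInChart_pullbackForm {G : M → V} (hG : ContMDiff I 𝓘(ℝ, V) ∞ G)
    (τ : V → V [⋀^Fin k]→L[ℝ] ℝ) (x : M) :
    formInChart (pullbackForm I G τ) x =ᶠ[𝓝 (extChartAt I x x)]
      fun y => (τ ((G ∘ (extChartAt I x).symm) y)).compContinuousLinearMap
        (fderiv ℝ (G ∘ (extChartAt I x).symm) y) := by
  filter_upwards [extChartAt_target_mem_nhds (I := I) x] with y hy
  ext v
  change τ _ (fun i => mvfderiv I G ((extChartAt I x).symm y)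
    (mfderivWithin 𝓘(ℝ, E) I (extChartAt I x).symm (Set.range I) y (v i))) = τ _ _
  congr 1
  funext i
  exact mvfderiv_mfderivWithin_extChartAt_symm hy ((hG _).of_le (by simp)) (v i)

lemma differentiableAt_formInChart_pullbackForm {G : M → V} (hG : ContMDiff I 𝓘(ℝ, V) ∞ G)
    {τ : V → V [⋀^Fin k]→L[ℝ] ℝ} {x : M} (hτ : DifferentiableAt ℝ τ (G x)) :
    DifferentiableAt ℝ (formInChart (pullbackForm I G τ) x) (extChartAt I x x) := by
  refine DifferentiableAt.congr_of_eventuallyEq ?_ (formInChart_pullbackForm hG τ x)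
  have h1 := contDiffAt_comp_extChartAt_symm (hG x)
  have h2 : DifferentiableAt ℝ (τ ∘ (G ∘ (extChartAt I x).symm)) (extChartAt I x x) := by
    refine DifferentiableAt.comp _ ?_ (h1.differentiableAt (by simp))
    rwa [Function.comp_apply, extChartAt_to_inv]
  have h3 : DifferentiableAt ℝ (fderiv ℝ (G ∘ (extChartAt I x).symm)) (extChartAt I x x) :=
    (h1.fderiv_right (m := 1)
      (by simpa [one_add_one_eq_two] using two_le_infty)).differentiableAt one_ne_zero
  exact (h2.hasFDerivAt.continuousAlternatingMapCompContinuousLinearMap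
    h3.hasFDerivAt).differentiableAt

/-- In the chart, the form is the pull-back under the smooth map `G ∘ (extChartAt I x).symm` of
vector spaces, where `d` commutes with pull-back. This reduces exterior derivatives on `S¹ × S³` to
the flat ambient space. -/
lemma extD_pullbackForm {G : M → V} (hG : ContMDiff I 𝓘(ℝ, V) ∞ G)
    {τ : V → V [⋀^Fin k]→L[ℝ] ℝ} {x : M} (hτ : DifferentiableAt ℝ τ (G x)) :
    extD (pullbackForm I G τ) x = pullbackForm I G (extDeriv τ) x := by
  ext v
  have h1 := contDiffAt_comp_extChartAt_symm (hG x)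
  have hx : (G ∘ (extChartAt I x).symm) (extChartAt I x x) = G x := by simp
  refine (extD_apply (E := E) _ x v).trans ?_
  rw [(formInChart_pullbackForm hG τ x).extDeriv_eq,
    extDeriv_pullback (r := ∞) (by rwa [hx]) h1
      (by simpa using two_le_infty), hx, pullbackForm_apply]
  change extDeriv τ _ _ = _
  congr 1
  funext i
  exact (mvfderiv_eq_fderiv_comp (E := E) ((hG x).of_le (by simp)) (v i)).symm

omit [IsManifold I ∞ M] [I.Boundaryless] in
lemma extDeriv_smul_apply {φ : E → ℝ} {η : E → E [⋀^Fin k]→L[ℝ] ℝ} {x : E}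
    (hφ : DifferentiableAt ℝ φ x) (hη : DifferentiableAt ℝ η x) (v : Fin (k + 1) → E) :
    extDeriv (φ • η) x v = φ x * extDeriv η x v +
      ∑ i, (-1) ^ i.val * (fderiv ℝ φ x (v i) * η x (i.removeNth v)) := by
  rw [extDeriv, extDeriv, fderiv_smul hφ hη,
    ContinuousAlternatingMap.alternatizeUncurryFin_apply,
    ContinuousAlternatingMap.alternatizeUncurryFin_apply, Finset.mul_sum,
    ← Finset.sum_add_distrib]
  refine Finset.sum_congr rfl fun i _ => ?_
  simp
  ring

/-- The Leibniz rule `d(φη) = φ dη + dφ ∧ η`, with the wedge product written out as an alternating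
sum. -/
lemma extD_smul_apply {φ : M → ℝ} {η : DiffForm I M k} {x : M}
    (hφ : ContMDiffAt I 𝓘(ℝ, ℝ) 1 φ x)
    (hη : DifferentiableAt ℝ (formInChart η x) (extChartAt I x x))
    (v : Fin (k + 1) → TangentSpace I x) :
    extD (fun y => φ y • η y) x v = φ x * extD η x v +
      ∑ i, (-1) ^ i.val * (mvfderiv I φ x (v i) * η x (i.removeNth v)) := by
  have h1 : formInChart (fun y => φ y • η y) x =
      (φ ∘ (extChartAt I x).symm) • formInChart η x := rfl
  have h2 : DifferentiableAt ℝ (φ ∘ (extChartAt I x).symm) (extChartAt I x x) :=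
    (contDiffAt_comp_extChartAt_symm hφ).differentiableAt one_ne_zero
  have h3 : (φ ∘ (extChartAt I x).symm) (extChartAt I x x) = φ x := by simp
  refine (extD_apply (E := E) _ x v).trans ?_
  refine Eq.trans ?_ (congrArg₂ (fun a b : ℝ => φ x * a + b) (extD_apply (E := E) η x v).symm
    (Finset.sum_congr rfl fun i _ => congrArg₂ (fun a b : ℝ => (-1) ^ i.val * (a * b))
      (mvfderiv_eq_fderiv_comp (E := E) hφ (v i)).symm
      (formInChart_self (E := E) η x (i.removeNth v))))
  rw [h1, ← h3]
  exact extDeriv_smul_apply (E := E) h2 hη v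

end ExteriorDerivative

/-! ### Pull-back of smooth bilinear forms -/

section BilinearPullback

variable {E : Type*} [NormedAddCommGroup E] [NormedSpace ℝ E]
  {H : Type*} [TopologicalSpace H] {I : ModelWithCorners ℝ E H}
  {M : Type*} [TopologicalSpace M] [ChartedSpace H M]
  {V : Type*} [NormedAddCommGroup V] [NormedSpace ℝ V]

/-- The pull-back of a field of bilinear forms along the differential of a map `G`. -/
def pullbackBilin (I : ModelWithCorners ℝ E H) (G : M → V) (B : M → V →L[ℝ] V →L[ℝ] ℝ) :
    BilinField I M :=
  fun x => (ContinuousLinearMap.precomp ℝ (mvfderiv I G x)) ∘L B x ∘L mvfderiv I G x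

lemma pullbackBilin_apply (G : M → V) (B : M → V →L[ℝ] V →L[ℝ] ℝ) (x : M)
    (v w : TangentSpace I x) :
    pullbackBilin I G B x v w = B x (mvfderiv I G x v) (mvfderiv I G x w) := rfl

/-- In the trivialization at `x` the pull-back is `B` with the differential of `G`, read in tangent
coordinates, inserted in both slots; that differential depends smoothly on the point. -/
lemma contMDiffAt_pullbackBilin [IsManifold I 1 M] {G : M → V} {B : M → V →L[ℝ] V →L[ℝ] ℝ} {x : M}
    (hG : ContMDiffAt I 𝓘(ℝ, V) ∞ G x) (hB : ContMDiffAt I 𝓘(ℝ, V →L[ℝ] V →L[ℝ] ℝ) ∞ B x) :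
    ContMDiffAt I (I.prod 𝓘(ℝ, E →L[ℝ] E →L[ℝ] ℝ)) ∞
      (fun x => Bundle.TotalSpace.mk' (E →L[ℝ] E →L[ℝ] ℝ)
        (E := fun x : M => TangentSpace I x →L[ℝ] TangentSpace I x →L[ℝ] ℝ) x
          (pullbackBilin I G B x)) x := by
  rw [contMDiffAt_hom_bundle]
  refine ⟨contMDiffAt_id, ?_⟩
  have hT := hG.mfderiv_const (m := ∞) (by simp)
  have key : ContMDiffAt I 𝓘(ℝ, E →L[ℝ] E →L[ℝ] ℝ) ∞ (fun y => (B y).bilinearComp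
    (inTangentCoordinates I 𝓘(ℝ, V) id G (mfderiv I 𝓘(ℝ, V) G) x y : E →L[ℝ] V)
    (inTangentCoordinates I 𝓘(ℝ, V) id G (mfderiv I 𝓘(ℝ, V) G) x y : E →L[ℝ] V)) x := by
    have h0 : ContDiff ℝ ∞ (fun T : E →L[ℝ] V => (ContinuousLinearMap.compL ℝ E V ℝ).flip T) :=
      ContinuousLinearMap.contDiff _
    have h1 := h0.contMDiff.contMDiffAt.comp x hT
    exact h1.clm_comp (hB.clm_comp hT)
  refine key.congr_of_eventuallyEq ?_
  filter_upwards [(trivializationAt E (TangentSpace I) x).open_baseSet.mem_nhds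
    (FiberBundle.mem_baseSet_trivializationAt' x)] with y hy
  ext v w
  refine (inCoordinates_apply_eq₂ hy hy (by simp)).trans ?_
  have h2 : ∀ v, inTangentCoordinates I 𝓘(ℝ, V) id G (mfderiv I 𝓘(ℝ, V) G) x y v =
      mvfderiv I G y ((trivializationAt E (TangentSpace I) x).symm y v) := by
    intro v
    simp only [inTangentCoordinates, ContinuousLinearMap.inCoordinates]
    simp only [TangentBundle.continuousLinearMapAt_model_space]
    change mvfderiv I G y ((trivializationAt E (TangentSpace I) x).symmL ℝ y v) = _
    rw [Bundle.Trivialization.symmL_apply]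
    exact hy
  simp [pullbackBilin_apply, h2]

end BilinearPullback

/-! ### Smoothness of inverse maps -/

section Inverse

variable {E : Type*} [NormedAddCommGroup E] [NormedSpace ℝ E] [CompleteSpace E]
  {H : Type*} [TopologicalSpace H] {I : ModelWithCorners ℝ E H} [I.Boundaryless]
  {M : Type*} [TopologicalSpace M] [ChartedSpace H M]
  {F : Type*} [NormedAddCommGroup F] [NormedSpace ℝ F] [CompleteSpace F]
  {H' : Type*} [TopologicalSpace H'] {J : ModelWithCorners ℝ F H'} [J.Boundaryless]
  {N : Type*} [TopologicalSpace N] [ChartedSpace H' N]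

/-- The inverse of a smooth homeomorphism with bijective differentials is smooth. -/
lemma contMDiff_homeomorph_symm (e : M ≃ₜ N) {n : ℕ∞ω} (hn : n ≠ 0) (he : ContMDiff I J n e)
    (hb : ∀ x, Function.Bijective (mfderiv I J e x)) : ContMDiff J I n e.symm := by
  intro y
  obtain ⟨x, rfl⟩ := e.surjective y
  rw [contMDiffAt_iff]
  refine ⟨e.symm.continuous.continuousAt, ?_⟩
  rw [J.range_eq_univ, contDiffWithinAt_univ]
  have h1 := (contMDiffAt_iff.1 (he x)).2
  rw [I.range_eq_univ, contDiffWithinAt_univ] at h1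
  have h2 : mfderiv I J e x = fderiv ℝ (extChartAt J (e x) ∘ e ∘ (extChartAt I x).symm)
      (extChartAt I x x) := by
    rw [((he x).mdifferentiableAt hn).mfderiv, I.range_eq_univ, fderivWithin_univ]
    rfl
  have h3 := hb x
  rw [h2] at h3
  let f' : E ≃L[ℝ] F := ContinuousLinearEquiv.ofBijective
    (fderiv ℝ (extChartAt J (e x) ∘ e ∘ (extChartAt I x).symm) (extChartAt I x x))
    (LinearMap.ker_eq_bot.2 h3.1) (LinearMap.range_eq_top.2 h3.2)
  have h4 : HasFDerivAt (extChartAt J (e x) ∘ e ∘ (extChartAt I x).symm) (f' : E →L[ℝ] F)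
      (extChartAt I x x) := (h1.differentiableAt hn).hasFDerivAt
  -- The inverse function theorem gives a smooth local inverse in the charts; by uniqueness it
  -- coincides near the point with the chart expression of `e.symm`.
  have h5 := h1.to_localInverse h4 hn
  have h6 : (extChartAt J (e x) ∘ e ∘ (extChartAt I x).symm) (extChartAt I x x) =
    extChartAt J (e x) (e x) := by simp
  rw [h6] at h5
  refine h5.congr_of_eventuallyEq ?_
  rw [← h6]
  have := (h1.hasStrictFDerivAt' h4 hn).localInverse_unique
    (g := extChartAt I (e.symm (e x)) ∘ e.symm ∘ (extChartAt J (e x)).symm) ?_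
  · exact this
  have hc : ContinuousAt (e ∘ (extChartAt I x).symm) (extChartAt I x x) :=
    e.continuous.continuousAt.comp (continuousAt_extChartAt_symm x)
  have h7 := hc.preimage_mem_nhds (t := (extChartAt J (e x)).source)
    (by simpa using extChartAt_source_mem_nhds (I := J) (e x))
  filter_upwards [h7, extChartAt_target_mem_nhds (I := I) x] with z hz hz'
  have h8 : (extChartAt J (e x)).symm (extChartAt J (e x) (e ((extChartAt I x).symm z))) =
     e ((extChartAt I x).symm z) := (extChartAt J (e x)).left_inv hz
  simp only [Function.comp_apply, h8, e.symm_apply_apply]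
  exact (extChartAt I x).right_inv hz'

end Inverse

/-! ### The map `hopfMap` is a bijection -/

section Bijection

variable {P : HopfPair} {a b : ℂ}

lemma normSq_xi_add (Q : S3) : ‖xi1 Q‖ ^ 2 + ‖xi2 Q‖ ^ 2 = 1 := by
  rw [← Complex.normSq_eq_norm_sq, ← Complex.normSq_eq_norm_sq, Complex.normSq_apply,
    Complex.normSq_apply]
  have := S3_sum_sq Q
  simp only [xi1, xi2]
  linarith

lemma S3_ext {Q Q' : S3} (h1 : xi1 Q = xi1 Q') (h2 : xi2 Q = xi2 Q') : Q = Q' := by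
  apply Subtype.ext
  ext i
  fin_cases i
  · exact congrArg Complex.re h1
  · exact congrArg Complex.im h1
  · exact congrArg Complex.re h2
  · exact congrArg Complex.im h2

lemma exists_S3 {z w : ℂ} (h : ‖z‖ ^ 2 + ‖w‖ ^ 2 = 1) : ∃ Q : S3, xi1 Q = z ∧ xi2 Q = w := by
  refine ⟨⟨!₂[z.re, z.im, w.re, w.im], ?_⟩, rfl, rfl⟩
  rw [← Complex.normSq_eq_norm_sq, ← Complex.normSq_eq_norm_sq, Complex.normSq_apply,
    Complex.normSq_apply] at h
  rw [mem_sphere_zero_iff_norm, EuclideanSpace.norm_eq, Real.sqrt_eq_one, Fin.sum_univ_four]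
  simp
  linarith

lemma re_eq_log_norm {w z : ℂ} (h : Complex.exp w = z) : w.re = Real.log ‖z‖ := by
  rw [← h, Complex.norm_exp, Real.log_exp]

lemma re_pos_left (ha : Complex.exp a = P.α) : 0 < a.re := by
  rw [re_eq_log_norm ha]
  exact Real.log_pos (P.one_lt.trans_le P.le)

lemma re_pos_right (hb : Complex.exp b = P.β) : 0 < b.re := by
  rw [re_eq_log_norm hb]
  exact Real.log_pos P.one_lt

lemma hopfLift_val (θ : ℝ) (Q : S3) : (hopfLift P a b θ Q).val =
    (Complex.exp (θ * a / (2 * Real.pi)) * xi1 Q, Complex.exp (θ * b / (2 * Real.pi)) * xi2 Q) :=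
  rfl

lemma exp_add_int_mul_two_pi {w z : ℂ} (h : Complex.exp w = z) (θ : ℝ) (n : ℤ) :
    Complex.exp ((θ + n * (2 * Real.pi) : ℝ) * w / (2 * Real.pi)) =
      z ^ n * Complex.exp (θ * w / (2 * Real.pi)) := by
  rw [← h, ← Complex.exp_int_mul, ← Complex.exp_add]
  congr 1
  have : (Real.pi : ℂ) ≠ 0 := by exact_mod_cast Real.pi_ne_zero
  push_cast
  field_simp
  ring

/-- Full turns of the angle are deck transformations; hence `hopfMap` does not depend on the chosen
argument. -/
lemma hopfLift_add_int_mul_two_pi (ha : Complex.exp a = P.α) (hb : Complex.exp b = P.β)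
    (θ : ℝ) (Q : S3) (n : ℤ) :
    hopfLift P a b (θ + n * (2 * Real.pi)) Q = n +ᵥ hopfLift P a b θ Q := by
  apply Punctured.ext
  rw [Punctured.vadd_val, hopfLift_val, hopfLift_val, exp_add_int_mul_two_pi ha,
    exp_add_int_mul_two_pi hb, mul_assoc, mul_assoc]

lemma mk_hopfLift_eq_of_exp_eq (ha : Complex.exp a = P.α) (hb : Complex.exp b = P.β)
    {θ θ' : ℝ} (h : Circle.exp θ = Circle.exp θ') (Q : S3) :
    HopfSurface.mk (hopfLift P a b θ Q) = HopfSurface.mk (hopfLift P a b θ' Q) := by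
  obtain ⟨n, rfl⟩ := Circle.exp_eq_exp.1 h
  exact HopfSurface.mk_eq_mk.2 ⟨n, (hopfLift_add_int_mul_two_pi ha hb θ' Q n).symm⟩

lemma hopfMap_eq_of_exp_eq (ha : Complex.exp a = P.α) (hb : Complex.exp b = P.β) {p : S1S3}
    {θ : ℝ} (h : Circle.exp θ = p.1) :
    hopfMap P a b p = HopfSurface.mk (hopfLift P a b θ p.2) :=
  mk_hopfLift_eq_of_exp_eq ha hb (by rw [h, Circle.exp_arg]) p.2

lemma norm_exp_mul_div_two_pi (w : ℂ) (θ : ℝ) :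
    ‖Complex.exp (θ * w / (2 * Real.pi))‖ = Real.exp (θ * (w.re / (2 * Real.pi))) := by
  rw [Complex.norm_exp, ← mul_div_assoc]
  congr 1
  rw [show (θ * w / (2 * Real.pi) : ℂ) = ((θ / (2 * Real.pi) : ℝ) : ℂ) * w by push_cast; ring,
    Complex.re_ofReal_mul]
  ring

/-- If `s < t`, the exponential factors at `t` are strictly larger in norm, so no coordinate of `R`
exceeds that of `Q` in norm and a nonzero coordinate of `Q` strictly shrinks. Two points of the unit
sphere cannot be related in this way. -/
lemma hopfLift_le_of_eq (ha : 0 < a.re) (hb : 0 < b.re) {s t : ℝ} {Q R : S3}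
    (h : hopfLift P a b s Q = hopfLift P a b t R) : t ≤ s := by
  by_contra! hst
  have h' := congrArg Punctured.val h
  rw [hopfLift_val, hopfLift_val] at h'
  have key : ∀ {w z z' : ℂ}, 0 < w.re → Complex.exp (s * w / (2 * Real.pi)) * z =
      Complex.exp (t * w / (2 * Real.pi)) * z' → ‖z'‖ ≤ ‖z‖ ∧ (z ≠ 0 → ‖z'‖ < ‖z‖) := by
    intro w z z' hw hz
    have h1 := congrArg norm hz
    rw [norm_mul, norm_mul, norm_exp_mul_div_two_pi, norm_exp_mul_div_two_pi] at h1
    have hw' : 0 < w.re / (2 * Real.pi) := by positivity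
    have h2 : Real.exp (s * (w.re / (2 * Real.pi))) < Real.exp (t * (w.re / (2 * Real.pi))) :=
      Real.exp_lt_exp.2 (by gcongr)
    have h3 := Real.exp_pos (s * (w.re / (2 * Real.pi)))
    constructor
    · by_contra! hcon
      nlinarith [norm_nonneg z, norm_nonneg z']
    · intro hz0
      have := norm_pos_iff.2 hz0
      by_contra! hcon
      nlinarith [norm_nonneg z, norm_nonneg z']
  obtain ⟨k1, k1'⟩ := key ha (congrArg Prod.fst h')
  obtain ⟨k2, k2'⟩ := key hb (congrArg Prod.snd h')
  have hQ := normSq_xi_add Q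
  have hR := normSq_xi_add R
  by_cases h0 : xi1 Q = 0
  · have h1 : xi2 Q ≠ 0 := by
      intro h1
      simp [h0, h1] at hQ
    nlinarith [k2' h1, norm_nonneg (xi1 R), norm_nonneg (xi2 R), norm_nonneg (xi2 Q),
      norm_nonneg (xi1 Q)]
  · nlinarith [k1' h0, norm_nonneg (xi1 R), norm_nonneg (xi2 R), norm_nonneg (xi2 Q),
      norm_nonneg (xi1 Q)]

lemma hopfLift_inj (ha : 0 < a.re) (hb : 0 < b.re) {s t : ℝ} {Q R : S3}
    (h : hopfLift P a b s Q = hopfLift P a b t R) : s = t ∧ Q = R := by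
  obtain rfl : s = t := le_antisymm (hopfLift_le_of_eq ha hb h.symm) (hopfLift_le_of_eq ha hb h)
  have h' := congrArg Punctured.val h
  rw [hopfLift_val, hopfLift_val] at h'
  exact ⟨rfl, S3_ext (mul_left_cancel₀ (Complex.exp_ne_zero _) (congrArg Prod.fst h'))
    (mul_left_cancel₀ (Complex.exp_ne_zero _) (congrArg Prod.snd h'))⟩

lemma hopfMap_injective (ha : Complex.exp a = P.α) (hb : Complex.exp b = P.β) :
    Function.Injective (hopfMap P a b) := by
  intro p p' h
  obtain ⟨n, hn⟩ := HopfSurface.mk_eq_mk.1 h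
  rw [← hopfLift_add_int_mul_two_pi ha hb] at hn
  obtain ⟨h1, h2⟩ := hopfLift_inj (re_pos_left ha) (re_pos_right hb) hn
  refine Prod.ext ?_ h2.symm
  rw [← Circle.exp_arg p.1, ← Circle.exp_arg p'.1, Circle.exp_eq_exp]
  exact ⟨n, h1.symm⟩

/-- Two decaying exponentials with nonnegative coefficients, not both zero, add up to one at some
point. -/
lemma exists_add_exp_eq_one {A B M N : ℝ} (hA : 0 < A) (hB : 0 < B) (hM : 0 ≤ M) (hN : 0 ≤ N)
    (h : 0 < M + N) : ∃ t : ℝ, M * Real.exp (-(t * A)) + N * Real.exp (-(t * B)) = 1 := by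
  set F : ℝ → ℝ := fun t => M * Real.exp (-(t * A)) + N * Real.exp (-(t * B)) with hF
  have hc : Continuous F := by fun_prop
  have hF0 : F 0 = M + N := by simp [hF]
  set m := min A B
  have hm : 0 < m := lt_min hA hB
  -- Here `(M + N) e^{-tm} = 1`, where `m` is the slower rate. Comparing both exponentials with
  -- `e^{-tm}` gives `F t ≤ 1` if `t ≥ 0` and `F t ≥ 1` if `t ≤ 0`, while `F 0 = M + N` lies on the
  -- other side of `1`; the intermediate value theorem applies.
  set t := Real.log (M + N) / m with ht
  have htm : Real.exp (-(t * m)) * (M + N) = 1 := by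
    rw [ht, div_mul_cancel₀ _ hm.ne', Real.exp_neg, Real.exp_log h, inv_mul_cancel₀ h.ne']
  have hlast : ∃ t, F t = 1 := by
    rcases le_total 1 (M + N) with h1 | h1
    · have ht0 : 0 ≤ t := div_nonneg (Real.log_nonneg h1) hm.le
      refine mem_range_of_exists_le_of_exists_ge hc ⟨t, ?_⟩ ⟨0, by rw [hF0]; exact h1⟩
      have e1 : Real.exp (-(t * A)) ≤ Real.exp (-(t * m)) := by
        gcongr
        exact min_le_left _ _
      have e2 : Real.exp (-(t * B)) ≤ Real.exp (-(t * m)) := by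
        gcongr
        exact min_le_right _ _
      simp only [hF]
      nlinarith
    · have ht0 : t ≤ 0 := div_nonpos_of_nonpos_of_nonneg (Real.log_nonpos h.le h1) hm.le
      refine mem_range_of_exists_le_of_exists_ge hc ⟨0, by rw [hF0]; exact h1⟩ ⟨t, ?_⟩
      have e1 : Real.exp (-(t * m)) ≤ Real.exp (-(t * A)) :=
        Real.exp_le_exp.2 (neg_le_neg (mul_le_mul_of_nonpos_left (min_le_left _ _) ht0))
      have e2 : Real.exp (-(t * m)) ≤ Real.exp (-(t * B)) :=
        Real.exp_le_exp.2 (neg_le_neg (mul_le_mul_of_nonpos_left (min_le_right _ _) ht0))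
      simp only [hF]
      nlinarith
  exact hlast

/-- Flow `w` back for a time `t` that brings it onto the unit sphere. The squared norm along the
flow is a sum of exponentials, the squaring being the source of the factor `2` in the rates. -/
lemma exists_hopfLift_eq (ha : 0 < a.re) (hb : 0 < b.re) (w : Punctured P) :
    ∃ (t : ℝ) (Q : S3), hopfLift P a b t Q = w := by
  have hpos : 0 < ‖w.val.1‖ ^ 2 + ‖w.val.2‖ ^ 2 := by
    rcases eq_or_ne w.val.1 0 with h0 | h0
    · have h1 : w.val.2 ≠ 0 := fun h1 => w.val_ne (Prod.ext h0 h1)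
      have := norm_pos_iff.2 h1
      positivity
    · have := norm_pos_iff.2 h0
      positivity
  obtain ⟨t, ht⟩ := exists_add_exp_eq_one (A := 2 * (a.re / (2 * Real.pi)))
    (B := 2 * (b.re / (2 * Real.pi))) (by positivity) (by positivity) (sq_nonneg ‖w.val.1‖)
    (sq_nonneg ‖w.val.2‖) hpos
  have key : ∀ z v : ℂ, ‖(Complex.exp (t * v / (2 * Real.pi)))⁻¹ * z‖ ^ 2 =
      ‖z‖ ^ 2 * Real.exp (-(t * (2 * (v.re / (2 * Real.pi))))) := by
    intro z v
    rw [norm_mul, norm_inv, norm_exp_mul_div_two_pi, ← Real.exp_neg, mul_pow, ← Real.exp_nat_mul,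
      mul_comm]
    congr 2
    push_cast
    ring
  rw [← key, ← key] at ht
  obtain ⟨Q, h1, h2⟩ := exists_S3 ht
  refine ⟨t, Q, Punctured.ext ?_⟩
  rw [hopfLift_val, h1, h2, mul_inv_cancel_left₀ (Complex.exp_ne_zero _),
    mul_inv_cancel_left₀ (Complex.exp_ne_zero _)]

lemma hopfMap_surjective (ha : Complex.exp a = P.α) (hb : Complex.exp b = P.β) :
    Function.Surjective (hopfMap P a b) := by
  intro q
  obtain ⟨w, rfl⟩ := Quotient.mk_surjective q
  obtain ⟨t, Q, rfl⟩ := exists_hopfLift_eq (re_pos_left ha) (re_pos_right hb) w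
  exact ⟨(Circle.exp t, Q), hopfMap_eq_of_exp_eq ha hb rfl⟩

end Bijection

/-! ### Charts of the Hopf surface -/

section Charts

variable {P : HopfPair}

instance : T2Space (HopfSurface P) :=
  inferInstanceAs (T2Space (Quotient (AddAction.orbitRel ℤ (Punctured P))))

/-- A chart is a local inverse of the covering followed by the coordinates, so it sends a class to
the coordinates of some translate of its representative. By continuity of the action the same `n`
serves all points near `w₀`. -/
lemma extChartAt_mk_eventually (w₀ : Punctured P) : ∃ n : ℤ, ∀ᶠ w in 𝓝 w₀,
    extChartAt 𝓘(ℝ, ℂ × ℂ) (HopfSurface.mk w₀) (HopfSurface.mk w) = (n +ᵥ w).val := by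
  have hloc := HopfSurface.proj_isLocalHomeomorph P
  obtain ⟨z, hz⟩ : ∃ z : Punctured P, chartAt (ℂ × ℂ) (HopfSurface.mk w₀) =
    (hloc.localInverseAt (x := z)).trans (chartAt (ℂ × ℂ) z) := ⟨_, rfl⟩
  set L := hloc.localInverseAt (x := z) with hL
  have hmem := mem_chart_source (ℂ × ℂ) (HopfSurface.mk w₀)
  rw [hz, OpenPartialHomeomorph.trans_source] at hmem
  have hmk : HopfSurface.mk (L (HopfSurface.mk w₀)) = HopfSurface.mk w₀ :=
    hloc.apply_localInverseAt_of_mem hmem.1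
  obtain ⟨n, hn⟩ := HopfSurface.mk_eq_mk.1 hmk
  refine ⟨n, ?_⟩
  have hev : ∀ᶠ w in 𝓝 w₀, n +ᵥ w ∈ L.target :=
    (continuous_const_vadd n).continuousAt.preimage_mem_nhds (L.open_target.mem_nhds
      (by rw [hn]; exact L.map_source hmem.1))
  filter_upwards [hev] with w hw
  have h3 : L (HopfSurface.mk w) = n +ᵥ w := by
    have h4 := L.right_inv hw
    rw [hL, hloc.localInverseAt_symm, ← hL] at h4
    rw [← h4]
    congr 1
    exact (HopfSurface.mk_eq_mk.2 ⟨n, rfl⟩).symm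
  rw [extChartAt_coe, modelWithCornersSelf_coe, Function.id_comp, hz,
    OpenPartialHomeomorph.coe_trans, Function.comp_apply, h3, Punctured.chartAt_apply]

/-- The linear map `(z₁, z₂) ↦ (αⁿ z₁, βⁿ z₂)`. -/
def deckMap (P : HopfPair) (n : ℤ) : (ℂ × ℂ) →L[ℂ] (ℂ × ℂ) :=
  (P.α ^ n • ContinuousLinearMap.id ℂ ℂ).prodMap (P.β ^ n • ContinuousLinearMap.id ℂ ℂ)

lemma deckMap_apply (n : ℤ) (z : ℂ × ℂ) : deckMap P n z = (P.α ^ n * z.1, P.β ^ n * z.2) := rfl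

lemma deckMap_bijective (n : ℤ) : Function.Bijective (deckMap P n) := by
  refine Function.bijective_iff_has_inverse.2 ⟨deckMap P (-n), fun z => ?_, fun z => ?_⟩ <;>
  simp [deckMap_apply, zpow_ne_zero, P.α_ne, P.β_ne]

variable {E : Type*} [NormedAddCommGroup E] [NormedSpace ℝ E]
  {H : Type*} [TopologicalSpace H] {I : ModelWithCorners ℝ E H}
  {M : Type*} [TopologicalSpace M] [ChartedSpace H M] {F : M → HopfSurface P} {x : M}
  {ζ : M → Punctured P}

lemma exists_extChartAt_comp_eventuallyEq (hζ : ContinuousAt ζ x)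
    (hF : ∀ᶠ y in 𝓝 x, F y = HopfSurface.mk (ζ y)) :
    ∃ n : ℤ, extChartAt 𝓘(ℝ, ℂ × ℂ) (F x) ∘ F =ᶠ[𝓝 x] fun y => deckMap P n (ζ y).val := by
  obtain ⟨n, hn⟩ := extChartAt_mk_eventually (ζ x)
  refine ⟨n, ?_⟩
  filter_upwards [hF, hζ.eventually hn] with y hy hy'
  rw [Function.comp_apply, hF.self_of_nhds, hy, hy', Punctured.vadd_val, deckMap_apply]

lemma contMDiffAt_of_lift (hζ : ContinuousAt ζ x)
    (hζs : ContMDiffAt I 𝓘(ℝ, ℂ × ℂ) ∞ (fun y => (ζ y).val) x)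
    (hF : ∀ᶠ y in 𝓝 x, F y = HopfSurface.mk (ζ y)) :
    ContMDiffAt I 𝓘(ℝ, ℂ × ℂ) ∞ F x := by
  obtain ⟨n, hn⟩ := exists_extChartAt_comp_eventuallyEq hζ hF
  rw [contMDiffAt_iff_target]
  constructor
  · have h1 : ContinuousAt (HopfSurface.mk ∘ ζ) x :=
      ((HopfSurface.proj_isLocalHomeomorph P).continuous.continuousAt).comp hζ
    exact h1.congr (hF.mono fun y hy => hy.symm)
  · refine ContMDiffAt.congr_of_eventuallyEq ?_ hn
    have h2 : ContDiff ℝ ∞ (deckMap P n) := ((deckMap P n).restrictScalars ℝ).contDiff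
    exact h2.contMDiff.contMDiffAt.comp x hζs

/-- Since `deckMap P n` is complex linear and bijective, the differential of `F` inherits
bijectivity and compatibility with `i` from that of the lift. -/
lemma exists_mfderiv_eq_of_lift (hζ : ContinuousAt ζ x)
    (hζs : ContMDiffAt I 𝓘(ℝ, ℂ × ℂ) ∞ (fun y => (ζ y).val) x)
    (hF : ∀ᶠ y in 𝓝 x, F y = HopfSurface.mk (ζ y)) :
    ∃ n : ℤ, ∀ v : TangentSpace I x, mfderiv I 𝓘(ℝ, ℂ × ℂ) F x v =
      deckMap P n (mvfderiv I (fun y => (ζ y).val) x v) := by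
  obtain ⟨n, hn⟩ := exists_extChartAt_comp_eventuallyEq hζ hF
  refine ⟨n, fun v => ?_⟩
  have h1 := (contMDiffAt_of_lift hζ hζs hF).mdifferentiableAt (by simp)
  have h2 : ContDiff ℝ ∞ (deckMap P n) := ((deckMap P n).restrictScalars ℝ).contDiff
  have h3 : MDifferentiableAt 𝓘(ℝ, ℂ × ℂ) 𝓘(ℝ, ℂ × ℂ) (deckMap P n) (ζ x).val :=
    (h2.differentiable (by simp) _).mdifferentiableAt
  have h4 := mfderiv_comp_apply x h3 (hζs.mdifferentiableAt (by simp)) v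
  have h5 : mfderiv I 𝓘(ℝ, ℂ × ℂ) F x =
      mfderiv I 𝓘(ℝ, ℂ × ℂ) (extChartAt 𝓘(ℝ, ℂ × ℂ) (F x) ∘ F) x := by
    have h6 : MDifferentiableAt I 𝓘(ℝ, ℂ × ℂ) (extChartAt 𝓘(ℝ, ℂ × ℂ) (F x) ∘ F) x :=
      ((h2.contMDiff.contMDiffAt.comp x hζs).congr_of_eventuallyEq hn).mdifferentiableAt (by simp)
    rw [h1.mfderiv, h6.mfderiv]
    rfl
  rw [h5, hn.mfderiv_eq]
  refine h4.trans ?_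
  rw [mfderiv_eq_fderiv]
  have : fderiv ℝ (deckMap P n) (ζ x).val = (deckMap P n).restrictScalars ℝ :=
    ((deckMap P n).restrictScalars ℝ).fderiv
  rw [this]
  rfl

end Charts

/-! ### Tangent vectors of `S¹ × S³` in the ambient space -/

/-- The ambient space `ℂ × ℝ⁴` of `S¹ × S³`. -/
abbrev Ambient : Type := ℂ × EuclideanSpace ℝ (Fin 4)

section AmbientForms

/-- The real part of the first component. -/
def ambientRe : Ambient →L[ℝ] ℝ := Complex.reCLM ∘L ContinuousLinearMap.fst ℝ _ _

/-- The imaginary part of the first component. -/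
def ambientIm : Ambient →L[ℝ] ℝ := Complex.imCLM ∘L ContinuousLinearMap.fst ℝ _ _

/-- The coordinates of the second component. -/
def ambientCoord (i : Fin 4) : Ambient →L[ℝ] ℝ :=
  EuclideanSpace.proj i ∘L ContinuousLinearMap.snd ℝ _ _

@[simp] lemma ambientRe_apply (y : Ambient) : ambientRe y = y.1.re := rfl
@[simp] lemma ambientIm_apply (y : Ambient) : ambientIm y = y.1.im := rfl
@[simp] lemma ambientCoord_apply (i : Fin 4) (y : Ambient) : ambientCoord i y = y.2 i := rfl

/-- The one-forms `⟨e, ·⟩` on the ambient space, where `e` runs over the frame, as linear functions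
of the base point. -/
def ambientCoframe : Fin 4 → Ambient →L[ℝ] Ambient →L[ℝ] ℝ :=
  ![ambientRe.smulRight ambientIm - ambientIm.smulRight ambientRe,
    (ambientCoord 0).smulRight (ambientCoord 1) - (ambientCoord 1).smulRight (ambientCoord 0) +
      (ambientCoord 2).smulRight (ambientCoord 3) - (ambientCoord 3).smulRight (ambientCoord 2),
    (ambientCoord 0).smulRight (ambientCoord 2) - (ambientCoord 2).smulRight (ambientCoord 0) +
      (ambientCoord 3).smulRight (ambientCoord 1) - (ambientCoord 1).smulRight (ambientCoord 3),
    (ambientCoord 0).smulRight (ambientCoord 3) - (ambientCoord 3).smulRight (ambientCoord 0) +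
      (ambientCoord 1).smulRight (ambientCoord 2) - (ambientCoord 2).smulRight (ambientCoord 1)]

lemma ambientCoframe_zero (y v : Ambient) :
    ambientCoframe 0 y v = y.1.re * v.1.im - y.1.im * v.1.re := by
  simp [ambientCoframe]

lemma ambientCoframe_one (y v : Ambient) : ambientCoframe 1 y v =
    y.2 0 * v.2 1 - y.2 1 * v.2 0 + y.2 2 * v.2 3 - y.2 3 * v.2 2 := by
  simp [ambientCoframe]

lemma ambientCoframe_two (y v : Ambient) : ambientCoframe 2 y v =
    y.2 0 * v.2 2 - y.2 2 * v.2 0 + y.2 3 * v.2 1 - y.2 1 * v.2 3 := by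
  simp [ambientCoframe]

lemma ambientCoframe_three (y v : Ambient) : ambientCoframe 3 y v =
    y.2 0 * v.2 3 - y.2 3 * v.2 0 + y.2 1 * v.2 2 - y.2 2 * v.2 1 := by
  simp [ambientCoframe]

/-- The frame vectors are orthonormal in `ℂ × ℝ⁴`, and each of these one-forms is the inner product
with a frame vector; so they restrict to the dual coframe. -/
lemma ambientCoframe_frameVec (p : S1S3) (j k : Fin 4) :
    ambientCoframe j (incl p) (frameVec p k) = if j = k then 1 else 0 := by
  have hQ := S3_sum_sq p.2
  have hz : (p.1 : ℂ).re ^ 2 + (p.1 : ℂ).im ^ 2 = 1 := by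
    have := Circle.normSq_coe p.1
    rw [Complex.normSq_apply] at this
    linarith
  fin_cases j <;> fin_cases k <;>
  simp [ambientCoframe_zero, ambientCoframe_one, ambientCoframe_two, ambientCoframe_three,
    incl, frameVec] <;> linarith

/-- The coordinates of a tangent vector in the frame. -/
def frameCoord (p : S1S3) (v : TangentSpace IS p) : Fin 4 → ℝ := (frame p).repr v

lemma frameCoord_frame (p : S1S3) (j k : Fin 4) :
    frameCoord p (frame p j) k = if j = k then 1 else 0 := by
  simp [frameCoord, Finsupp.single_apply]

lemma coframeOne_apply (p : S1S3) (v : TangentSpace IS p) : coframeOne p v = frameCoord p v 0 := rfl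

lemma mvfderiv_incl_eq_sum (p : S1S3) (v : TangentSpace IS p) :
    mvfderiv IS incl p v = ∑ k, frameCoord p v k • frameVec p k := by
  conv_lhs => rw [← (frame p).sum_repr v]
  rw [map_sum]
  refine Finset.sum_congr rfl fun k _ => ?_
  rw [map_smul, mvfderiv_incl_frame]
  rfl

lemma ambientCoframe_mvfderiv_incl (p : S1S3) (v : TangentSpace IS p) (k : Fin 4) :
    ambientCoframe k (incl p) (mvfderiv IS incl p v) = frameCoord p v k := by
  rw [mvfderiv_incl_eq_sum, map_sum]
  simp [ambientCoframe_frameVec]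

lemma mvfderiv_incl_fst (p : S1S3) (v : TangentSpace IS p) :
    (mvfderiv IS incl p v).1 = frameCoord p v 0 * (Complex.I * p.1) := by
  rw [mvfderiv_incl_eq_sum, Fin.sum_univ_four]
  simp [frameVec]

lemma mvfderiv_incl_snd (p : S1S3) (v : TangentSpace IS p) :
    (mvfderiv IS incl p v).2 =
      !₂[-frameCoord p v 1 * p.2.1 1 - frameCoord p v 2 * p.2.1 2 - frameCoord p v 3 * p.2.1 3,
        frameCoord p v 1 * p.2.1 0 + frameCoord p v 2 * p.2.1 3 - frameCoord p v 3 * p.2.1 2,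
        -frameCoord p v 1 * p.2.1 3 + frameCoord p v 2 * p.2.1 0 + frameCoord p v 3 * p.2.1 1,
        frameCoord p v 1 * p.2.1 2 - frameCoord p v 2 * p.2.1 1 + frameCoord p v 3 * p.2.1 0] := by
  rw [mvfderiv_incl_eq_sum, Fin.sum_univ_four]
  ext i
  fin_cases i <;> simp [frameVec] <;> ring

lemma contMDiff_incl : ContMDiff IS 𝓘(ℝ, Ambient) ∞ incl := by
  have h1 : ContMDiff (𝓡 1) 𝓘(ℝ, ℂ) ∞ (fun z : Circle => (z : ℂ)) := by
    have : Fact (Module.finrank ℝ ℂ = 1 + 1) := finrank_real_complex_fact'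
    exact contMDiff_coe_sphere (E := ℂ) (n := 1)
  have h2 : ContMDiff (𝓡 3) 𝓘(ℝ, EuclideanSpace ℝ (Fin 4)) ∞ (fun Q : S3 => Q.1) := by
    have : Fact (Module.finrank ℝ (EuclideanSpace ℝ (Fin 4)) = 3 + 1) := ⟨by simp⟩
    exact contMDiff_coe_sphere (n := 3)
  exact (h1.comp contMDiff_fst).prodMk_space (h2.comp contMDiff_snd)

lemma mvfderiv_comp_incl {F : Type*} [NormedAddCommGroup F] [NormedSpace ℝ F] {g : Ambient → F}
    {g' : Ambient →L[ℝ] F} {p : S1S3} (hg : HasFDerivAt g g' (incl p)) (v : TangentSpace IS p) :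
    mvfderiv IS (g ∘ incl) p v = g' (mvfderiv IS incl p v) := by
  have h := mfderiv_comp_apply p hg.differentiableAt.mdifferentiableAt
    ((contMDiff_incl p).mdifferentiableAt (by simp)) v
  rw [mfderiv_eq_fderiv, hg.fderiv] at h
  exact h

lemma contMDiffAt_comp_incl {F : Type*} [NormedAddCommGroup F] [NormedSpace ℝ F] {g : Ambient → F}
    {p : S1S3} {n : ℕ∞ω} (hn : n ≤ ∞) (hg : ContDiffAt ℝ n g (incl p)) :
    ContMDiffAt IS 𝓘(ℝ, F) n (g ∘ incl) p :=
  hg.contMDiffAt.comp p ((contMDiff_incl p).of_le hn)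

end AmbientForms

/-! ### Local lifts of `hopfMap` -/

section LocalLift

/-- The branch of the argument which takes the value `θ₀` at `e^{iθ₀}`. -/
def localArg (θ₀ : ℝ) (z : ℂ) : ℝ := θ₀ + (Complex.log (z * Complex.exp (-(θ₀ * Complex.I)))).im

/-- The open set where `localArg θ₀` is smooth. -/
def arcDomain (θ₀ : ℝ) : Set S1S3 :=
  {p | (p.1 : ℂ) * Complex.exp (-(θ₀ * Complex.I)) ∈ Complex.slitPlane}

lemma isOpen_arcDomain (θ₀ : ℝ) : IsOpen (arcDomain θ₀) := by
  refine Complex.isOpen_slitPlane.preimage (f := fun p : S1S3 =>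
    (p.1 : ℂ) * Complex.exp (-(θ₀ * Complex.I))) ?_
  have : Continuous (fun z : Circle => (z : ℂ)) := continuous_subtype_val
  fun_prop

lemma exp_mem_arcDomain (θ₀ : ℝ) (Q : S3) : (Circle.exp θ₀, Q) ∈ arcDomain θ₀ := by
  change ((Circle.exp θ₀ : Circle) : ℂ) * _ ∈ Complex.slitPlane
  rw [Circle.coe_exp, ← Complex.exp_add, add_neg_cancel,
    Complex.exp_zero]
  exact Complex.one_mem_slitPlane

lemma mem_arcDomain_arg (p : S1S3) : p ∈ arcDomain (Complex.arg p.1) := by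
  have := exp_mem_arcDomain (Complex.arg p.1) p.2
  rwa [Circle.exp_arg] at this

lemma circle_exp_localArg (θ₀ : ℝ) (z : Circle) : Circle.exp (localArg θ₀ z) = z := by
  have h : (z : ℂ) * Complex.exp (-(θ₀ * Complex.I)) = (z * Circle.exp (-θ₀) : Circle) := by
    rw [Circle.coe_mul, Circle.coe_exp]
    push_cast
    ring_nf
  rw [localArg, h, Complex.log_im, Circle.exp_add, Circle.exp_arg, mul_comm, mul_assoc,
    ← Circle.exp_add, neg_add_cancel, Circle.exp_zero, mul_one]

lemma contDiffAt_localArg {θ₀ : ℝ} {p : S1S3} (hp : p ∈ arcDomain θ₀) {n : ℕ∞ω} :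
    ContDiffAt ℝ n (fun y : Ambient => localArg θ₀ y.1) (incl p) := by
  have h1 : ContDiffAt ℝ n Complex.log ((incl p).1 * Complex.exp (-(θ₀ * Complex.I))) :=
    (Complex.contDiffAt_log hp).restrict_scalars ℝ
  have h2 : ContDiffAt ℝ n (fun y : Ambient => y.1 * Complex.exp (-(θ₀ * Complex.I))) (incl p) := by
    fun_prop
  have h3 := h1.comp (incl p) h2
  exact contDiffAt_const.add (Complex.imCLM.contDiff.contDiffAt.comp _ h3)

/-- The differential of `log z` is `dz / z`, and on the unit circle `1 / z` is the conjugate of `z`;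
its imaginary part is `x dy - y dx`. Off the circle a factor `1 / |z|²` would appear. -/
lemma hasFDerivAt_localArg {θ₀ : ℝ} {p : S1S3} (hp : p ∈ arcDomain θ₀) :
    HasFDerivAt (fun y : Ambient => localArg θ₀ y.1) (ambientCoframe 0 (incl p)) (incl p) := by
  set k := Complex.exp (-(θ₀ * Complex.I)) with hk
  have h1 := (Complex.hasDerivAt_log (z := (incl p).1 * k) hp).hasFDerivAt.restrictScalars ℝ
  have h2 := (ContinuousLinearMap.fst ℝ ℂ (EuclideanSpace ℝ (Fin 4))).hasFDerivAt.mul_const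
    (x := incl p) k
  have h3 := (Complex.imCLM.hasFDerivAt.comp (incl p) (h1.comp (incl p) h2)).const_add θ₀
  refine h3.congr_fderiv (ContinuousLinearMap.ext fun v => ?_)
  have hz : ((incl p).1)⁻¹ = (starRingEnd ℂ) (incl p).1 := by
    change ((p.1 : ℂ))⁻¹ = (starRingEnd ℂ) (p.1 : ℂ)
    rw [← Circle.coe_inv, Circle.coe_inv_eq_conj]
  have hk0 : k ≠ 0 := Complex.exp_ne_zero _
  have h4 : ((incl p).1 * k)⁻¹ * (k * v.1) = (starRingEnd ℂ) (incl p).1 * v.1 := by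
    rw [mul_inv, hz]
    field_simp
  rw [ambientCoframe_zero]
  change Complex.im ((k * v.1) * ((incl p).1 * k)⁻¹) = _
  rw [mul_comm, h4]
  simp
  ring

/-- The complex coordinate `ξ₁` as a function on the ambient space. -/
def ambientXi1 : Ambient →L[ℝ] ℂ :=
  (ambientCoord 0).smulRight 1 + (ambientCoord 1).smulRight Complex.I

/-- The complex coordinate `ξ₂` as a function on the ambient space. -/
def ambientXi2 : Ambient →L[ℝ] ℂ :=
  (ambientCoord 2).smulRight 1 + (ambientCoord 3).smulRight Complex.I

lemma ambientXi1_apply (y : Ambient) : ambientXi1 y = ⟨y.2 0, y.2 1⟩ := by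
  apply Complex.ext <;> simp [ambientXi1]

lemma ambientXi2_apply (y : Ambient) : ambientXi2 y = ⟨y.2 2, y.2 3⟩ := by
  apply Complex.ext <;> simp [ambientXi2]

lemma ambientXi1_incl (p : S1S3) : ambientXi1 (incl p) = xi1 p.2 := ambientXi1_apply _

lemma ambientXi2_incl (p : S1S3) : ambientXi2 (incl p) = xi2 p.2 := ambientXi2_apply _

lemma ambientXi1_mvfderiv_incl (p : S1S3) (v : TangentSpace IS p) :
    ambientXi1 (mvfderiv IS incl p v) = frameCoord p v 1 * (Complex.I * xi1 p.2) -
      (frameCoord p v 2 + frameCoord p v 3 * Complex.I) * (starRingEnd ℂ) (xi2 p.2) := by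
  rw [ambientXi1_apply, mvfderiv_incl_snd]
  apply Complex.ext <;> simp [xi1, xi2] <;> ring

lemma ambientXi2_mvfderiv_incl (p : S1S3) (v : TangentSpace IS p) :
    ambientXi2 (mvfderiv IS incl p v) = frameCoord p v 1 * (Complex.I * xi2 p.2) +
      (frameCoord p v 2 + frameCoord p v 3 * Complex.I) * (starRingEnd ℂ) (xi1 p.2) := by
  rw [ambientXi2_apply, mvfderiv_incl_snd]
  apply Complex.ext <;> simp [xi1, xi2] <;> ring

/-- The lift of `hopfMap` which is given by the branch `localArg θ₀` of the argument, as a function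
on the ambient space. -/
def localLift (a b : ℂ) (θ₀ : ℝ) (y : Ambient) : ℂ × ℂ :=
  (Complex.exp (localArg θ₀ y.1 * a / (2 * Real.pi)) * ambientXi1 y,
    Complex.exp (localArg θ₀ y.1 * b / (2 * Real.pi)) * ambientXi2 y)

lemma hopfLift_localArg (P : HopfPair) (a b : ℂ) (θ₀ : ℝ) (p : S1S3) :
    (hopfLift P a b (localArg θ₀ p.1) p.2).val = localLift a b θ₀ (incl p) := by
  rw [hopfLift_val, localLift, ambientXi1_incl, ambientXi2_incl]
  rfl

lemma contDiffAt_localLift (a b : ℂ) {θ₀ : ℝ} {p : S1S3} (hp : p ∈ arcDomain θ₀) {n : ℕ∞ω} :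
    ContDiffAt ℝ n (localLift a b θ₀) (incl p) := by
  have h1 : ContDiffAt ℝ n (fun y : Ambient => (localArg θ₀ y.1 : ℂ)) (incl p) :=
    Complex.ofRealCLM.contDiff.contDiffAt.comp _ (contDiffAt_localArg hp)
  have h2 : ContDiff ℝ n ambientXi1 := ambientXi1.contDiff
  have h3 : ContDiff ℝ n ambientXi2 := ambientXi2.contDiff
  have h4 : ∀ w : ℂ, ContDiffAt ℝ n
      (fun y : Ambient => Complex.exp (localArg θ₀ y.1 * w / (2 * Real.pi))) (incl p) := fun w =>
    ((h1.mul contDiffAt_const).div_const _).cexp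
  exact ((h4 a).mul h2.contDiffAt).prodMk ((h4 b).mul h3.contDiffAt)

lemma hasFDerivAt_exp_localArg_mul (w : ℂ) (φ : Ambient →L[ℝ] ℂ) {θ₀ : ℝ} {p : S1S3}
    (hp : p ∈ arcDomain θ₀) : ∃ L : Ambient →L[ℝ] ℂ,
    HasFDerivAt (fun y : Ambient => Complex.exp (localArg θ₀ y.1 * w / (2 * Real.pi)) * φ y) L
      (incl p) ∧ ∀ v, L v = Complex.exp (localArg θ₀ p.1 * w / (2 * Real.pi)) *
        (ambientCoframe 0 (incl p) v * (w / (2 * Real.pi)) * φ (incl p) + φ v) := by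
  have h1 := Complex.ofRealCLM.hasFDerivAt.comp _ (hasFDerivAt_localArg hp)
  have h2 := ((h1.mul_const (w / (2 * Real.pi))).cexp).mul φ.hasFDerivAt
  refine ⟨_, h2.congr_of_eventuallyEq (.of_forall fun y => ?_), fun v => ?_⟩
  · simp [mul_div_assoc]
  · simp [incl, mul_div_assoc]
    ring

end LocalLift

/-! ### The complex structure in the frame -/

section ComplexStructure

lemma xi_mul_conj_add (Q : S3) :
    xi1 Q * (starRingEnd ℂ) (xi1 Q) + xi2 Q * (starRingEnd ℂ) (xi2 Q) = 1 := by
  rw [Complex.mul_conj, Complex.mul_conj, Complex.normSq_eq_norm_sq, Complex.normSq_eq_norm_sq]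
  exact_mod_cast normSq_xi_add Q

/-- The function `G / 2π = (|ξ₁|² log α + |ξ₂|² log β) / 2π`. -/
def coefC (a b : ℂ) (Q : S3) : ℂ :=
  (a * (xi1 Q * (starRingEnd ℂ) (xi1 Q)) + b * (xi2 Q * (starRingEnd ℂ) (xi2 Q))) / (2 * Real.pi)

/-- The function `(log β - log α) ξ₁ ξ₂ / 2π`. -/
def coefD (a b : ℂ) (Q : S3) : ℂ := (b - a) * (xi1 Q * xi2 Q) / (2 * Real.pi)

/-- The coordinates of a tangent vector in the complex basis `(e₂, e₃)`. -/
def complexCoord (a b : ℂ) (p : S1S3) : TangentSpace IS p →ₗ[ℝ] (Fin 2 → ℂ) where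
  toFun v := ![frameCoord p v 1 - Complex.I * coefC a b p.2 * frameCoord p v 0,
    frameCoord p v 2 + frameCoord p v 3 * Complex.I + coefD a b p.2 * frameCoord p v 0]
  map_add' v w := by
    funext i
    fin_cases i <;> simp [frameCoord] <;> ring
  map_smul' r v := by
    funext i
    fin_cases i <;> simp [frameCoord] <;> ring

lemma complexCoord_zero (a b : ℂ) (p : S1S3) (v : TangentSpace IS p) : complexCoord a b p v 0 =
    frameCoord p v 1 - Complex.I * coefC a b p.2 * frameCoord p v 0 := rfl

lemma complexCoord_one (a b : ℂ) (p : S1S3) (v : TangentSpace IS p) : complexCoord a b p v 1 =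
    frameCoord p v 2 + frameCoord p v 3 * Complex.I + coefD a b p.2 * frameCoord p v 0 := rfl

variable {a b : ℂ}

lemma coefC_re (a b : ℂ) (Q : S3) :
    (coefC a b Q).re = (a.re * ‖xi1 Q‖ ^ 2 + b.re * ‖xi2 Q‖ ^ 2) / (2 * Real.pi) := by
  rw [coefC, Complex.mul_conj, Complex.mul_conj, Complex.normSq_eq_norm_sq,
    Complex.normSq_eq_norm_sq,
    show (2 * Real.pi : ℂ) = ((2 * Real.pi : ℝ) : ℂ) by push_cast; rfl, Complex.div_ofReal_re,
    Complex.add_re, Complex.re_mul_ofReal, Complex.re_mul_ofReal]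

lemma coefC_im (a b : ℂ) (Q : S3) :
    (coefC a b Q).im = (a.im * ‖xi1 Q‖ ^ 2 + b.im * ‖xi2 Q‖ ^ 2) / (2 * Real.pi) := by
  rw [coefC, Complex.mul_conj, Complex.mul_conj, Complex.normSq_eq_norm_sq,
    Complex.normSq_eq_norm_sq,
    show (2 * Real.pi : ℂ) = ((2 * Real.pi : ℝ) : ℂ) by push_cast; rfl, Complex.div_ofReal_im,
    Complex.add_im, Complex.im_mul_ofReal, Complex.im_mul_ofReal]

lemma coefC_re_pos (ha : 0 < a.re) (hb : 0 < b.re) (Q : S3) : 0 < (coefC a b Q).re := by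
  rw [coefC_re]
  have h := normSq_xi_add Q
  have : 0 < a.re * ‖xi1 Q‖ ^ 2 + b.re * ‖xi2 Q‖ ^ 2 := by
    rcases (sq_nonneg ‖xi1 Q‖).eq_or_lt with h0 | h0
    · rw [← h0, zero_add] at h
      rw [← h0, h]
      linarith
    · positivity
  positivity

/-- The imaginary part of the first coordinate is `-Re C` times `e¹`, and `Re C > 0`. A vector in
the kernel therefore has no `e₁` component, after which the coordinates are just the remaining frame
coordinates. Both spaces have real dimension four. -/
lemma complexCoord_bijective (ha : 0 < a.re) (hb : 0 < b.re) (p : S1S3) :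
    Function.Bijective (complexCoord a b p) := by
  have : FiniteDimensional ℝ (TangentSpace IS p) := (frame p).finiteDimensional_of_finite
  have hfin : Module.finrank ℝ (TangentSpace IS p) = Module.finrank ℝ (Fin 2 → ℂ) := by
    rw [Module.finrank_eq_card_basis (frame p), Module.finrank_pi_fintype]
    simp [Complex.finrank_real_complex]
  have hinj : Function.Injective (complexCoord a b p) := by
    rw [injective_iff_map_eq_zero]
    intro v hv
    have h0 := congrFun hv 0
    have h1 := congrFun hv 1
    rw [complexCoord_zero, Pi.zero_apply] at h0
    rw [complexCoord_one, Pi.zero_apply] at h1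
    have hc := coefC_re_pos ha hb p.2
    have e0 : frameCoord p v 0 = 0 := by
      have := congrArg Complex.im h0
      simp at this
      exact this.resolve_left hc.ne'
    rw [e0] at h0 h1
    simp at h0 h1
    have e2 := congrArg Complex.re h1
    have e3 := congrArg Complex.im h1
    simp at e2 e3
    apply (frame p).repr.injective
    ext k
    change frameCoord p v k = _
    fin_cases k <;> simp [e0, h0, e2, e3]
  exact ⟨hinj, (LinearMap.injective_iff_surjective_of_finrank_eq_finrank hfin).1 hinj⟩

/-- The differential of `localLift` in terms of `complexCoord`. -/
def liftMatrix (u w : ℂ) (Q : S3) (c : Fin 2 → ℂ) : ℂ × ℂ :=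
  (u * (c 0 * (Complex.I * xi1 Q) - c 1 * (starRingEnd ℂ) (xi2 Q)),
    w * (c 0 * (Complex.I * xi2 Q) + c 1 * (starRingEnd ℂ) (xi1 Q)))

lemma liftMatrix_smul (u w z : ℂ) (Q : S3) (c : Fin 2 → ℂ) :
    liftMatrix u w Q (z • c) = z • liftMatrix u w Q c := by
  ext <;> simp [liftMatrix] <;> ring

/-- Apart from the factors `u` and `w`, the matrix has columns `(iξ₁, iξ₂)` and `(-conj ξ₂, conj
ξ₁)` and is unitary; the inverse given here divides by the factors and applies the conjugate
transpose. -/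
lemma liftMatrix_bijective {u w : ℂ} (hu : u ≠ 0) (hw : w ≠ 0) (Q : S3) :
    Function.Bijective (liftMatrix u w Q) := by
  have hQ := xi_mul_conj_add Q
  refine Function.bijective_iff_has_inverse.2 ⟨fun z =>
    ![-Complex.I * ((starRingEnd ℂ) (xi1 Q) * (u⁻¹ * z.1) + (starRingEnd ℂ) (xi2 Q) * (w⁻¹ * z.2)),
      xi1 Q * (w⁻¹ * z.2) - xi2 Q * (u⁻¹ * z.1)], fun c => ?_, fun z => ?_⟩
  · funext i
    fin_cases i
    · simp only [liftMatrix, inv_mul_cancel_left₀ hu, inv_mul_cancel_left₀ hw]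
      simp
      linear_combination (-Complex.I * Complex.I * c 0) * hQ - c 0 * Complex.I_sq
    · simp only [liftMatrix, inv_mul_cancel_left₀ hu, inv_mul_cancel_left₀ hw]
      simp
      linear_combination (c 1) * hQ
  · have h1 := mul_inv_cancel_left₀ hu z.1
    have h2 := mul_inv_cancel_left₀ hw z.2
    refine Prod.ext ?_ ?_
    · simp only [liftMatrix, Matrix.cons_val_zero, Matrix.cons_val_one]
      linear_combination (u * (u⁻¹ * z.1)) * hQ + h1 - (u * xi1 Q * ((starRingEnd ℂ) (xi1 Q) *
        (u⁻¹ * z.1) + (starRingEnd ℂ) (xi2 Q) * (w⁻¹ * z.2))) * Complex.I_sq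
    · simp only [liftMatrix, Matrix.cons_val_zero, Matrix.cons_val_one]
      linear_combination (w * (w⁻¹ * z.2)) * hQ + h2 - (w * xi2 Q * ((starRingEnd ℂ) (xi1 Q) *
        (u⁻¹ * z.1) + (starRingEnd ℂ) (xi2 Q) * (w⁻¹ * z.2))) * Complex.I_sq

/-- On `e₂, e₃, e₄` this is the definition of the frame. Along `e₁` the exponentials contribute `(a
ξ₁, b ξ₂) / 2π`, whose coefficients in the unitary basis are `-iC` and `D`; `hC1` and `hC2` record
this decomposition. -/
lemma mvfderiv_localLift {θ₀ : ℝ} {p : S1S3} (hp : p ∈ arcDomain θ₀) (v : TangentSpace IS p) :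
    mvfderiv IS (localLift a b θ₀ ∘ incl) p v =
      liftMatrix (Complex.exp (localArg θ₀ p.1 * a / (2 * Real.pi)))
        (Complex.exp (localArg θ₀ p.1 * b / (2 * Real.pi))) p.2 (complexCoord a b p v) := by
  obtain ⟨L1, h1, h1'⟩ := hasFDerivAt_exp_localArg_mul a ambientXi1 hp
  obtain ⟨L2, h2, h2'⟩ := hasFDerivAt_exp_localArg_mul b ambientXi2 hp
  rw [mvfderiv_comp_incl (g := localLift a b θ₀) (h1.prodMk h2)]
  have hQ := xi_mul_conj_add p.2
  have hC1 : a * xi1 p.2 * (xi1 p.2 * (starRingEnd ℂ) (xi1 p.2) + xi2 p.2 *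
      (starRingEnd ℂ) (xi2 p.2)) / (2 * Real.pi) =
      coefC a b p.2 * xi1 p.2 - coefD a b p.2 * (starRingEnd ℂ) (xi2 p.2) := by
    rw [coefC, coefD]
    ring
  have hC2 : b * xi2 p.2 * (xi1 p.2 * (starRingEnd ℂ) (xi1 p.2) + xi2 p.2 *
      (starRingEnd ℂ) (xi2 p.2)) / (2 * Real.pi) =
      coefC a b p.2 * xi2 p.2 + coefD a b p.2 * (starRingEnd ℂ) (xi1 p.2) := by
    rw [coefC, coefD]
    ring
  change (L1 _, L2 _) = _
  rw [h1', h2', ambientCoframe_mvfderiv_incl, ambientXi1_incl, ambientXi2_incl,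
    ambientXi1_mvfderiv_incl, ambientXi2_mvfderiv_incl]
  simp only [liftMatrix, complexCoord_zero, complexCoord_one]
  generalize Complex.exp (localArg θ₀ p.1 * a / (2 * Real.pi)) = u
  generalize Complex.exp (localArg θ₀ p.1 * b / (2 * Real.pi)) = w
  refine Prod.ext ?_ ?_
  · linear_combination (-(u * frameCoord p v 0 * a * xi1 p.2 / (2 * Real.pi))) * hQ +
      (u * frameCoord p v 0 * xi1 p.2 * coefC a b p.2) * Complex.I_sq +
      u * frameCoord p v 0 * hC1
  · linear_combination (-(w * frameCoord p v 0 * b * xi2 p.2 / (2 * Real.pi))) * hQ +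
      (w * frameCoord p v 0 * xi2 p.2 * coefC a b p.2) * Complex.I_sq +
      w * frameCoord p v 0 * hC2

variable {P : HopfPair}

lemma hopfMap_eq_mk_localArg (ha : Complex.exp a = P.α) (hb : Complex.exp b = P.β) (θ₀ : ℝ)
    (p : S1S3) : hopfMap P a b p = HopfSurface.mk (hopfLift P a b (localArg θ₀ p.1) p.2) :=
  hopfMap_eq_of_exp_eq ha hb (circle_exp_localArg θ₀ p.1)

lemma contMDiffAt_localLift {θ₀ : ℝ} {p : S1S3} (hp : p ∈ arcDomain θ₀) :
    ContMDiffAt IS 𝓘(ℝ, ℂ × ℂ) ∞ (localLift a b θ₀ ∘ incl) p :=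
  contMDiffAt_comp_incl le_rfl (contDiffAt_localLift a b hp)

lemma hopfLift_localArg_val (θ₀ : ℝ) :
    (fun p : S1S3 => (hopfLift P a b (localArg θ₀ p.1) p.2).val) = localLift a b θ₀ ∘ incl :=
  funext fun p => hopfLift_localArg P a b θ₀ p

lemma continuousAt_hopfLift_localArg {θ₀ : ℝ} {p : S1S3} (hp : p ∈ arcDomain θ₀) :
    ContinuousAt (fun p : S1S3 => hopfLift P a b (localArg θ₀ p.1) p.2) p := by
  refine Topology.IsInducing.subtypeVal.continuousAt_iff.2 ?_
  have := (contMDiffAt_localLift (a := a) (b := b) hp).continuousAt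
  rwa [← hopfLift_localArg_val (P := P)] at this

lemma contMDiff_hopfMap (ha : Complex.exp a = P.α) (hb : Complex.exp b = P.β) :
    ContMDiff IS 𝓘(ℝ, ℂ × ℂ) ∞ (hopfMap P a b) := by
  intro p
  have hp := mem_arcDomain_arg p
  refine contMDiffAt_of_lift (continuousAt_hopfLift_localArg hp) ?_
    (.of_forall (hopfMap_eq_mk_localArg ha hb _))
  rw [hopfLift_localArg_val]
  exact contMDiffAt_localLift hp

lemma exists_mfderiv_hopfMap_eq (ha : Complex.exp a = P.α) (hb : Complex.exp b = P.β) {θ₀ : ℝ}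
    {p : S1S3} (hp : p ∈ arcDomain θ₀) : ∃ n : ℤ, ∀ v : TangentSpace IS p,
      mfderiv IS 𝓘(ℝ, ℂ × ℂ) (hopfMap P a b) p v =
        deckMap P n (mvfderiv IS (localLift a b θ₀ ∘ incl) p v) := by
  have := exists_mfderiv_eq_of_lift (P := P) (continuousAt_hopfLift_localArg hp)
    (by rw [hopfLift_localArg_val]; exact contMDiffAt_localLift (a := a) (b := b) hp)
    (.of_forall (hopfMap_eq_mk_localArg ha hb θ₀))
  rwa [hopfLift_localArg_val] at this

lemma mvfderiv_localLift_bijective (ha : 0 < a.re) (hb : 0 < b.re) {θ₀ : ℝ} {p : S1S3}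
    (hp : p ∈ arcDomain θ₀) : Function.Bijective (mvfderiv IS (localLift a b θ₀ ∘ incl) p) := by
  have h := (liftMatrix_bijective (Complex.exp_ne_zero (localArg θ₀ p.1 * a / (2 * Real.pi)))
    (Complex.exp_ne_zero (localArg θ₀ p.1 * b / (2 * Real.pi))) p.2).comp
    (complexCoord_bijective ha hb p)
  convert! h using 1
  exact funext fun v => mvfderiv_localLift hp v

lemma mfderiv_hopfMap_bijective (ha : Complex.exp a = P.α) (hb : Complex.exp b = P.β) (p : S1S3) :
    Function.Bijective (mfderiv IS 𝓘(ℝ, ℂ × ℂ) (hopfMap P a b) p) := by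
  obtain ⟨n, hn⟩ := exists_mfderiv_hopfMap_eq ha hb (mem_arcDomain_arg p)
  have h := (deckMap_bijective (P := P) n).comp
    (mvfderiv_localLift_bijective (re_pos_left ha) (re_pos_right hb) (mem_arcDomain_arg p))
  convert! h using 1
  exact funext hn

/-- The total function `inverse` in the definition of `hopfJ` is a genuine inverse because the
differential of `hopfMap` is bijective. -/
lemma mfderiv_hopfMap_hopfJ (ha : Complex.exp a = P.α) (hb : Complex.exp b = P.β) (p : S1S3)
    (v : TangentSpace IS p) :
    mfderiv IS 𝓘(ℝ, ℂ × ℂ) (hopfMap P a b) p (hopfJ P a b p v) =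
      hopfI P (hopfMap P a b p) (mfderiv IS 𝓘(ℝ, ℂ × ℂ) (hopfMap P a b) p v) := by
  have hinv : (mfderiv IS 𝓘(ℝ, ℂ × ℂ) (hopfMap P a b) p).IsInvertible := by
    have hbij := mfderiv_hopfMap_bijective ha hb p
    exact ⟨ContinuousLinearEquiv.ofBijective
      (E := EuclideanSpace ℝ (Fin 1) × EuclideanSpace ℝ (Fin 3)) (F := ℂ × ℂ)
      (mfderiv IS 𝓘(ℝ, ℂ × ℂ) (hopfMap P a b) p)
      (LinearMap.ker_eq_bot.2 hbij.1) (LinearMap.range_eq_top.2 hbij.2), rfl⟩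
  exact hinv.self_apply_inverse _

lemma mvfderiv_localLift_hopfJ (ha : Complex.exp a = P.α) (hb : Complex.exp b = P.β) {θ₀ : ℝ}
    {p : S1S3} (hp : p ∈ arcDomain θ₀) (v : TangentSpace IS p) :
    mvfderiv IS (localLift a b θ₀ ∘ incl) p (hopfJ P a b p v) =
      Complex.I • mvfderiv IS (localLift a b θ₀ ∘ incl) p v := by
  obtain ⟨n, hn⟩ := exists_mfderiv_hopfMap_eq ha hb hp
  have h := mfderiv_hopfMap_hopfJ ha hb p v
  rw [hn, hn] at h
  apply (deckMap_bijective (P := P) n).1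
  rw [h, map_smul]
  rfl

/-- The differential of the local lift intertwines `J` with `i`, and it factors as the injective,
complex homogeneous `liftMatrix` after `complexCoord`. -/
lemma complexCoord_hopfJ (ha : Complex.exp a = P.α) (hb : Complex.exp b = P.β) (p : S1S3)
    (v : TangentSpace IS p) :
    complexCoord a b p (hopfJ P a b p v) = Complex.I • complexCoord a b p v := by
  have hp := mem_arcDomain_arg p
  have h := mvfderiv_localLift_hopfJ ha hb hp v
  rw [mvfderiv_localLift hp, mvfderiv_localLift hp, ← liftMatrix_smul] at h
  exact (liftMatrix_bijective (Complex.exp_ne_zero _) (Complex.exp_ne_zero _) p.2).1 h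

lemma isComplexStructure_hopfJ (ha : Complex.exp a = P.α) (hb : Complex.exp b = P.β) :
    IsComplexStructure (hopfJ P a b) := fun p =>
  ⟨arcDomain (Complex.arg p.1), isOpen_arcDomain _, mem_arcDomain_arg p, localLift a b _ ∘ incl,
    fun _ hy => (contMDiffAt_localLift hy).contMDiffWithinAt, fun _ hy =>
    ⟨mvfderiv_localLift_bijective (re_pos_left ha) (re_pos_right hb) hy,
      mvfderiv_localLift_hopfJ ha hb hy⟩⟩

/-- The diffeomorphism `F_{α,β}`. -/
def hopfDiffeomorph (ha : Complex.exp a = P.α) (hb : Complex.exp b = P.β) :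
    S1S3 ≃ₘ⟮IS, 𝓘(ℝ, ℂ × ℂ)⟯ HopfSurface P where
  toEquiv := Equiv.ofBijective (hopfMap P a b)
    ⟨hopfMap_injective ha hb, hopfMap_surjective ha hb⟩
  contMDiff_toFun := contMDiff_hopfMap ha hb
  -- A continuous bijection from the compact `S¹ × S³` to a Hausdorff space is a homeomorphism;
  -- bijective differentials then make its inverse smooth.
  contMDiff_invFun := contMDiff_homeomorph_symm
    (Continuous.homeoOfEquivCompactToT2 (f := Equiv.ofBijective (hopfMap P a b)
      ⟨hopfMap_injective ha hb, hopfMap_surjective ha hb⟩) (contMDiff_hopfMap ha hb).continuous)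
    (by simp) (contMDiff_hopfMap ha hb) (mfderiv_hopfMap_bijective ha hb)

lemma complexCoord_complexComb (ha : Complex.exp a = P.α) (hb : Complex.exp b = P.β) (p : S1S3)
    (c : Fin 2 → ℂ) : complexCoord a b p
      (complexComb (hopfJ P a b p) (frame p 1) (frame p 2) c) = c := by
  rw [complexComb]
  simp only [map_add, map_smul, complexCoord_hopfJ ha hb]
  funext i
  fin_cases i
  · apply Complex.ext <;> simp [complexCoord_zero, frameCoord_frame]
  · apply Complex.ext <;> simp [complexCoord_one, frameCoord_frame]

lemma complexComb_complexCoord (ha : Complex.exp a = P.α) (hb : Complex.exp b = P.β) (p : S1S3)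
    (v : TangentSpace IS p) :
    complexComb (hopfJ P a b p) (frame p 1) (frame p 2) (complexCoord a b p v) = v :=
  (complexCoord_bijective (re_pos_left ha) (re_pos_right hb) p).1
    (complexCoord_complexComb ha hb p _)

lemma isComplexBasis_hopfJ (ha : Complex.exp a = P.α) (hb : Complex.exp b = P.β) (p : S1S3) :
    IsComplexBasis (hopfJ P a b p) (frame p 1) (frame p 2) :=
  Function.bijective_iff_has_inverse.2 ⟨complexCoord a b p, complexCoord_complexComb ha hb p,
    complexComb_complexCoord ha hb p⟩

end ComplexStructure

/-! ### The metric -/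

section Metric

/-- The Hermitian form with matrix `hopfMatrix P t Q`, real part. -/
def hopfForm (P : HopfPair) (t : ℝ) (Q : S3) (c d : Fin 2 → ℂ) : ℝ :=
  (∑ i, ∑ j, c i * hopfMatrix P t Q i j * (starRingEnd ℂ) (d j)).re

variable {P : HopfPair} {a b : ℂ}

lemma hopfForm_eq (t : ℝ) (Q : S3) (c d : Fin 2 → ℂ) : hopfForm P t Q c d =
    (Real.pi * t / reG P Q ^ 2 + ‖xi1 Q‖ ^ 2 * ‖xi2 Q‖ ^ 2 *
        Real.log (‖P.α‖ / ‖P.β‖) ^ 2 / reG P Q ^ 3) *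
      ((c 0).re * (d 0).re + (c 0).im * (d 0).im) +
    1 / reG P Q * ((c 1).re * (d 1).re + (c 1).im * (d 1).im) +
    Real.log (‖P.α‖ / ‖P.β‖) / reG P Q ^ 2 *
      ((xi1 Q * xi2 Q).re * ((c 0).re * (d 1).im - (c 0).im * (d 1).re +
          ((c 1).im * (d 0).re - (c 1).re * (d 0).im)) -
        (xi1 Q * xi2 Q).im * ((c 0).re * (d 1).re + (c 0).im * (d 1).im +
          ((c 1).re * (d 0).re + (c 1).im * (d 0).im))) := by
  have h01 : hopfMatrix P t Q 0 1 =
      ((Real.log (‖P.α‖ / ‖P.β‖) / reG P Q ^ 2 : ℝ) : ℂ) * (Complex.I * (xi1 Q * xi2 Q)) := by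
    simp only [hopfMatrix, Matrix.of_apply, Matrix.cons_val_zero, Matrix.cons_val_one,
      Complex.ofReal_div, Complex.ofReal_pow]
    ring
  have h10 : hopfMatrix P t Q 1 0 = ((Real.log (‖P.α‖ / ‖P.β‖) / reG P Q ^ 2 : ℝ) : ℂ) *
      (starRingEnd ℂ) (Complex.I * (xi1 Q * xi2 Q)) := by
    simp only [hopfMatrix, Matrix.of_apply, Matrix.cons_val_zero, Matrix.cons_val_one,
      Complex.ofReal_div, Complex.ofReal_pow, mul_assoc]
    ring
  have h11 : hopfMatrix P t Q 1 1 = ((1 / reG P Q : ℝ) : ℂ) := by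
    rw [Complex.ofReal_div, Complex.ofReal_one]
    rfl
  have h00 : hopfMatrix P t Q 0 0 = ((Real.pi * t / reG P Q ^ 2 + ‖xi1 Q‖ ^ 2 * ‖xi2 Q‖ ^ 2 *
      Real.log (‖P.α‖ / ‖P.β‖) ^ 2 / reG P Q ^ 3 : ℝ) : ℂ) := rfl
  simp only [hopfForm, Fin.sum_univ_two, h00, h01, h10, h11]
  generalize xi1 Q * xi2 Q = w
  generalize Real.log (‖P.α‖ / ‖P.β‖) / reG P Q ^ 2 = k
  generalize 1 / reG P Q = l
  generalize Real.pi * t / reG P Q ^ 2 + ‖xi1 Q‖ ^ 2 * ‖xi2 Q‖ ^ 2 *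
      Real.log (‖P.α‖ / ‖P.β‖) ^ 2 / reG P Q ^ 3 = n
  simp
  ring

lemma hopfForm_symm (t : ℝ) (Q : S3) (c d : Fin 2 → ℂ) :
    hopfForm P t Q c d = hopfForm P t Q d c := by
  rw [hopfForm_eq, hopfForm_eq]
  ring

lemma hopfForm_I_smul (t : ℝ) (Q : S3) (c d : Fin 2 → ℂ) :
    hopfForm P t Q (Complex.I • c) (Complex.I • d) = hopfForm P t Q c d := by
  rw [hopfForm_eq, hopfForm_eq]
  simp
  ring

lemma reG_pos (P : HopfPair) (Q : S3) : 0 < reG P Q := by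
  have h := normSq_xi_add Q
  have h1 := Real.log_pos P.one_lt
  have h2 := Real.log_pos (P.one_lt.trans_le P.le)
  rw [reG]
  rcases (sq_nonneg ‖xi1 Q‖).eq_or_lt with h0 | h0
  · rw [← h0, zero_add] at h
    rw [← h0, h]
    linarith
  · positivity

/-- With `w = ξ₁ξ₂`, the second summand of the upper left entry is exactly what completes the
square: the form becomes `(πt/G²)|c₀|² + (1/G)|c₁ + (L/G) i w c₀|²`. -/
lemma hopfForm_pos {t : ℝ} (ht : 0 < t) (Q : S3) {c : Fin 2 → ℂ} (hc : c ≠ 0) :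
    0 < hopfForm P t Q c c := by
  have hG := reG_pos P Q
  have hw : ‖xi1 Q‖ ^ 2 * ‖xi2 Q‖ ^ 2 = (xi1 Q * xi2 Q).re ^ 2 + (xi1 Q * xi2 Q).im ^ 2 := by
    rw [← mul_pow, ← norm_mul, ← Complex.normSq_eq_norm_sq, Complex.normSq_apply]
    ring
  rw [hopfForm_eq, hw]
  generalize xi1 Q * xi2 Q = w
  generalize Real.log (‖P.α‖ / ‖P.β‖) = L
  set G := reG P Q
  have key : (Real.pi * t / G ^ 2 + (w.re ^ 2 + w.im ^ 2) * L ^ 2 / G ^ 3) *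
      ((c 0).re * (c 0).re + (c 0).im * (c 0).im) +
      1 / G * ((c 1).re * (c 1).re + (c 1).im * (c 1).im) +
      L / G ^ 2 * (w.re * ((c 0).re * (c 1).im - (c 0).im * (c 1).re +
          ((c 1).im * (c 0).re - (c 1).re * (c 0).im)) -
        w.im * ((c 0).re * (c 1).re + (c 0).im * (c 1).im +
          ((c 1).re * (c 0).re + (c 1).im * (c 0).im))) =
      Real.pi * t / G ^ 2 * Complex.normSq (c 0) +
        1 / G * Complex.normSq (c 1 + (L / G : ℝ) * (Complex.I * w * c 0)) := by
    rw [Complex.normSq_apply, Complex.normSq_apply]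
    simp
    field_simp
    ring
  rw [key]
  have hp := Real.pi_pos
  by_cases h0 : c 0 = 0
  · have h1 : c 1 ≠ 0 := by
      intro h1
      apply hc
      funext i
      fin_cases i
      · exact h0
      · exact h1
    simp only [h0, mul_zero, add_zero, map_zero, zero_add]
    have := Complex.normSq_pos.2 h1
    positivity
  · have := Complex.normSq_pos.2 h0
    have h2 := Complex.normSq_nonneg (c 1 + (L / G : ℝ) * (Complex.I * w * c 0))
    have h3 : 0 < Real.pi * t / G ^ 2 * Complex.normSq (c 0) := by positivity
    have h4 : 0 ≤ 1 / G * Complex.normSq (c 1 + (L / G : ℝ) * (Complex.I * w * c 0)) := by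
      positivity
    linarith

/-! ### Periodic functions on the circle and uniqueness of the metric -/

/-- The function on the circle induced by a function of the argument. -/
def circleFun (h : ℝ → ℝ) (z : Circle) : ℝ := h (Complex.arg z)

lemma circleFun_exp {h : ℝ → ℝ} (hp : Function.Periodic h (2 * Real.pi)) (θ : ℝ) :
    circleFun h (Circle.exp θ) = h θ := by
  obtain ⟨n, hn⟩ := Circle.exp_eq_exp.1 (Circle.exp_arg (Circle.exp θ))
  rw [circleFun, hn]
  exact hp.int_mul n θ

lemma circleFun_eq_localArg {h : ℝ → ℝ} (hp : Function.Periodic h (2 * Real.pi)) (θ₀ : ℝ)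
    (z : Circle) : circleFun h z = h (localArg θ₀ z) := by
  rw [← circleFun_exp hp (localArg θ₀ z), circle_exp_localArg]

lemma contMDiff_circleFun {h : ℝ → ℝ} (hs : ContDiff ℝ ∞ h)
    (hp : Function.Periodic h (2 * Real.pi)) :
    ContMDiff IS 𝓘(ℝ, ℝ) ∞ (fun p : S1S3 => circleFun h p.1) := by
  intro p
  have h1 : (fun p : S1S3 => circleFun h p.1) =
      (fun y : Ambient => h (localArg (Complex.arg p.1) y.1)) ∘ incl :=
    funext fun q => circleFun_eq_localArg hp _ _
  rw [h1]
  exact contMDiffAt_comp_incl le_rfl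
    (hs.contDiffAt.comp _ (contDiffAt_localArg (mem_arcDomain_arg p)))

/-- As `complexCoord` inverts `complexComb` and every point of the circle is some `e^{iθ}`, the
matrix condition prescribes `g` completely. Periodicity makes the prescriptions for different `θ`
agree. -/
lemma isHopfMetric_iff (ha : Complex.exp a = P.α) (hb : Complex.exp b = P.β) {h : ℝ → ℝ}
    (hp : Function.Periodic h (2 * Real.pi)) {g : BilinField IS S1S3} :
    IsHopfMetric P a b h g ↔ ∀ (p : S1S3) (v w : TangentSpace IS p), g p v w =
      hopfForm P (circleFun h p.1) p.2 (complexCoord a b p v) (complexCoord a b p w) := by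
  constructor
  · rintro H ⟨z, Q⟩ v w
    obtain ⟨θ, rfl⟩ := Circle.exp_surjective z
    have := H θ Q (complexCoord a b _ v) (complexCoord a b _ w)
    rw [complexComb_complexCoord ha hb, complexComb_complexCoord ha hb] at this
    rw [circleFun_exp hp]
    exact this
  · intro H θ Q c d
    rw [H, complexCoord_complexComb ha hb, complexCoord_complexComb ha hb, circleFun_exp hp]
    rfl

/-! ### Smooth extension of the metric to the ambient space -/

/-- The quadratic function `κ₁ |ξ₁|² + κ₂ |ξ₂|²` on the ambient space. -/
def quad (κ₁ κ₂ : ℝ) (y : Ambient) : ℝ :=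
  κ₁ * (y.2 0 ^ 2 + y.2 1 ^ 2) + κ₂ * (y.2 2 ^ 2 + y.2 3 ^ 2)

lemma contDiff_ambient_apply {n : ℕ∞ω} (i : Fin 4) : ContDiff ℝ n (fun y : Ambient => y.2 i) :=
  (ambientCoord i).contDiff

lemma contDiff_quad (κ₁ κ₂ : ℝ) {n : ℕ∞ω} : ContDiff ℝ n (quad κ₁ κ₂) := by
  have := contDiff_ambient_apply (n := n)
  unfold quad
  exact (contDiff_const.mul (((this 0).pow 2).add ((this 1).pow 2))).add
    (contDiff_const.mul (((this 2).pow 2).add ((this 3).pow 2)))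

lemma quad_incl (κ₁ κ₂ : ℝ) (p : S1S3) :
    quad κ₁ κ₂ (incl p) = κ₁ * ‖xi1 p.2‖ ^ 2 + κ₂ * ‖xi2 p.2‖ ^ 2 := by
  rw [← Complex.normSq_eq_norm_sq, ← Complex.normSq_eq_norm_sq, Complex.normSq_apply,
    Complex.normSq_apply]
  simp only [quad, incl, xi1, xi2]
  ring

lemma coefC_re_eq_quad (p : S1S3) : (coefC a b p.2).re =
    quad (a.re / (2 * Real.pi)) (b.re / (2 * Real.pi)) (incl p) := by
  rw [quad_incl, coefC_re]
  ring

lemma coefC_im_eq_quad (p : S1S3) : (coefC a b p.2).im =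
    quad (a.im / (2 * Real.pi)) (b.im / (2 * Real.pi)) (incl p) := by
  rw [quad_incl, coefC_im]
  ring

lemma reG_eq_quad (p : S1S3) :
    reG P p.2 = quad (Real.log ‖P.α‖) (Real.log ‖P.β‖) (incl p) := by
  rw [quad_incl, reG]
  ring

/-- The real and imaginary parts of `complexCoord` as one-forms on the ambient space. -/
def ambientCoordForm (a b : ℂ) (y : Ambient) : Fin 4 → Ambient →L[ℝ] ℝ :=
  ![ambientCoframe 1 y + quad (a.im / (2 * Real.pi)) (b.im / (2 * Real.pi)) y • ambientCoframe 0 y,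
    -quad (a.re / (2 * Real.pi)) (b.re / (2 * Real.pi)) y • ambientCoframe 0 y,
    ambientCoframe 2 y +
      ((b - a) * (ambientXi1 y * ambientXi2 y) / (2 * Real.pi)).re • ambientCoframe 0 y,
    ambientCoframe 3 y +
      ((b - a) * (ambientXi1 y * ambientXi2 y) / (2 * Real.pi)).im • ambientCoframe 0 y]

lemma contDiff_ambientCoordForm (a b : ℂ) (k : Fin 4) {n : ℕ∞ω} :
    ContDiff ℝ n (fun y => ambientCoordForm a b y k) := by
  have h1 : ∀ j, ContDiff ℝ n (fun y => ambientCoframe j y) := fun j =>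
    (ambientCoframe j).contDiff
  have h2 := @contDiff_quad
  have h3 : ContDiff ℝ n (fun y => (b - a) * (ambientXi1 y * ambientXi2 y) / (2 * Real.pi)) :=
    (contDiff_const.mul (ambientXi1.contDiff.mul ambientXi2.contDiff)).div_const _
  fin_cases k
  · exact (h1 1).add ((h2 _ _).smul (h1 0))
  · exact (h2 _ _).neg.smul (h1 0)
  · exact (h1 2).add ((Complex.reCLM.contDiff.comp h3).smul (h1 0))
  · exact (h1 3).add ((Complex.imCLM.contDiff.comp h3).smul (h1 0))

lemma complexCoord_zero_re (p : S1S3) (v : TangentSpace IS p) : (complexCoord a b p v 0).re =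
    ambientCoordForm a b (incl p) 0 (mvfderiv IS incl p v) := by
  rw [complexCoord_zero]
  simp [ambientCoordForm, ambientCoframe_mvfderiv_incl, ← coefC_im_eq_quad]

lemma complexCoord_zero_im (p : S1S3) (v : TangentSpace IS p) : (complexCoord a b p v 0).im =
    ambientCoordForm a b (incl p) 1 (mvfderiv IS incl p v) := by
  rw [complexCoord_zero]
  simp [ambientCoordForm, ambientCoframe_mvfderiv_incl, ← coefC_re_eq_quad]

lemma complexCoord_one_re (p : S1S3) (v : TangentSpace IS p) : (complexCoord a b p v 1).re =
    ambientCoordForm a b (incl p) 2 (mvfderiv IS incl p v) := by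
  rw [complexCoord_one, coefD, ← ambientXi1_incl, ← ambientXi2_incl]
  simp [ambientCoordForm, ambientCoframe_mvfderiv_incl]

lemma complexCoord_one_im (p : S1S3) (v : TangentSpace IS p) : (complexCoord a b p v 1).im =
    ambientCoordForm a b (incl p) 3 (mvfderiv IS incl p v) := by
  rw [complexCoord_one, coefD, ← ambientXi1_incl, ← ambientXi2_incl]
  simp [ambientCoordForm, ambientCoframe_mvfderiv_incl]

/-- The form `ρⱼ ⊗ ρₖ`, where `ρ = ambientCoordForm a b y`. -/
def ambientTensor (a b : ℂ) (j k : Fin 4) (y : Ambient) : Ambient →L[ℝ] Ambient →L[ℝ] ℝ :=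
  (ambientCoordForm a b y j).smulRight (ambientCoordForm a b y k)

lemma contDiff_ambientTensor (a b : ℂ) (j k : Fin 4) {n : ℕ∞ω} :
    ContDiff ℝ n (ambientTensor a b j k) :=
  (contDiff_ambientCoordForm a b j).smulRight (contDiff_ambientCoordForm a b k)

/-- The real part of a Hermitian form with matrix `((n, k i w), (conj (k i w), l))`, where
`w = x + i y`, as a linear combination of the products `T j k` of the real coordinates. -/
def hermitianCombination {W : Type*} [NormedAddCommGroup W] [NormedSpace ℝ W] (n l k x y : ℝ)
    (T : Fin 4 → Fin 4 → W) : W :=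
  n • (T 0 0 + T 1 1) + l • (T 2 2 + T 3 3) +
    k • (x • (T 0 3 - T 1 2 + (T 3 0 - T 2 1)) - y • (T 0 2 + T 1 3 + (T 2 0 + T 3 1)))

lemma contDiffAt_hermitianCombination {V W : Type*} [NormedAddCommGroup V] [NormedSpace ℝ V]
    [NormedAddCommGroup W] [NormedSpace ℝ W] {r : ℕ∞ω} {n l k x y : V → ℝ}
    {T : Fin 4 → Fin 4 → V → W} {z : V} (hn : ContDiffAt ℝ r n z) (hl : ContDiffAt ℝ r l z)
    (hk : ContDiffAt ℝ r k z) (hx : ContDiffAt ℝ r x z) (hy : ContDiffAt ℝ r y z)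
    (hT : ∀ i j, ContDiffAt ℝ r (T i j) z) : ContDiffAt ℝ r
      (fun z => hermitianCombination (n z) (l z) (k z) (x z) (y z) fun i j => T i j z) z :=
  ((hn.smul ((hT 0 0).add (hT 1 1))).add (hl.smul ((hT 2 2).add (hT 3 3)))).add
    (hk.smul ((hx.smul (((hT 0 3).sub (hT 1 2)).add ((hT 3 0).sub (hT 2 1)))).sub
      (hy.smul (((hT 0 2).add (hT 1 3)).add ((hT 2 0).add (hT 3 1))))))

/-- A bilinear form on the ambient space which restricts to the metric `g^h_{α,β}`. -/
def ambientMetric (P : HopfPair) (a b : ℂ) (t : ℝ) (y : Ambient) :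
    Ambient →L[ℝ] Ambient →L[ℝ] ℝ :=
  let G := quad (Real.log ‖P.α‖) (Real.log ‖P.β‖) y
  let L := Real.log (‖P.α‖ / ‖P.β‖)
  let w := ambientXi1 y * ambientXi2 y
  hermitianCombination
    (Real.pi * t / G ^ 2 + quad 1 0 y * quad 0 1 y * L ^ 2 / G ^ 3) (1 / G) (L / G ^ 2) w.re w.im
    fun j k => ambientTensor a b j k y

/-- The value `t` of `h` is kept as a separate variable because it comes from a function on the
circle only. The sole denominators are powers of `Re G`, which is positive on the sphere. -/
lemma contDiffAt_ambientMetric (P : HopfPair) (a b : ℂ) (t : ℝ) (p : S1S3) :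
    ContDiffAt ℝ ∞ (fun z : ℝ × Ambient => ambientMetric P a b z.1 z.2) (t, incl p) := by
  have hG : ContDiffAt ℝ ∞ (fun z : ℝ × Ambient => quad (Real.log ‖P.α‖) (Real.log ‖P.β‖) z.2)
    (t, incl p) := ((contDiff_quad _ _).comp contDiff_snd).contDiffAt
  have hG0 : quad (Real.log ‖P.α‖) (Real.log ‖P.β‖) ((t, incl p) : ℝ × Ambient).2 ≠ 0 := by
    rw [← reG_eq_quad]
    exact (reG_pos P p.2).ne'
  have hq : ∀ κ₁ κ₂, ContDiffAt ℝ ∞ (fun z : ℝ × Ambient => quad κ₁ κ₂ z.2) (t, incl p) :=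
    fun _ _ => ((contDiff_quad _ _).comp contDiff_snd).contDiffAt
  have hT : ∀ j k, ContDiffAt ℝ ∞ (fun z : ℝ × Ambient => ambientTensor a b j k z.2)
    (t, incl p) := fun _ _ => ((contDiff_ambientTensor _ _ _ _).comp contDiff_snd).contDiffAt
  have hw : ContDiffAt ℝ ∞ (fun z : ℝ × Ambient => ambientXi1 z.2 * ambientXi2 z.2) (t, incl p) :=
    ((ambientXi1.contDiff.mul ambientXi2.contDiff).comp contDiff_snd).contDiffAt
  have hre := Complex.reCLM.contDiff.contDiffAt.comp _ hw
  have him := Complex.imCLM.contDiff.contDiffAt.comp _ hw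
  have ht : ContDiffAt ℝ ∞ (fun z : ℝ × Ambient => Real.pi * z.1) (t, incl p) :=
    contDiffAt_const.mul contDiffAt_fst
  have h1 := (ht.div (hG.pow 2) (pow_ne_zero 2 hG0)).add
    ((((hq 1 0).mul (hq 0 1)).mul (contDiffAt_const (c := Real.log (‖P.α‖ / ‖P.β‖) ^ 2))).div
      (hG.pow 3) (pow_ne_zero 3 hG0))
  have h2 := (contDiffAt_const (c := (1 : ℝ))).div hG hG0
  have h3 := (contDiffAt_const (c := Real.log (‖P.α‖ / ‖P.β‖))).div (hG.pow 2)
    (pow_ne_zero 2 hG0)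
  simp only [ambientMetric]
  exact contDiffAt_hermitianCombination h1 h2 h3 hre him hT

/-- The metric `g^h_{α,β}`. -/
def hopfMetric (P : HopfPair) (a b : ℂ) (h : ℝ → ℝ) : BilinField IS S1S3 :=
  pullbackBilin IS incl fun p => ambientMetric P a b (circleFun h p.1) (incl p)

lemma hopfMetric_apply (h : ℝ → ℝ) (p : S1S3) (v w : TangentSpace IS p) :
    hopfMetric P a b h p v w =
      hopfForm P (circleFun h p.1) p.2 (complexCoord a b p v) (complexCoord a b p w) := by
  have h1 : quad 1 0 (incl p) = ‖xi1 p.2‖ ^ 2 := by rw [quad_incl]; ring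
  have h2 : quad 0 1 (incl p) = ‖xi2 p.2‖ ^ 2 := by rw [quad_incl]; ring
  rw [hopfMetric, pullbackBilin_apply, hopfForm_eq, complexCoord_zero_re, complexCoord_zero_re,
    complexCoord_zero_im, complexCoord_zero_im, complexCoord_one_re, complexCoord_one_re,
    complexCoord_one_im, complexCoord_one_im]
  simp only [ambientMetric, hermitianCombination, ambientTensor, ← reG_eq_quad,
    ambientXi1_incl, ambientXi2_incl, h1, h2, add_apply, sub_apply, smul_apply,
    ContinuousLinearMap.smulRight_apply, smul_eq_mul]

lemma isHopfMetric_hopfMetric (ha : Complex.exp a = P.α) (hb : Complex.exp b = P.β) {h : ℝ → ℝ}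
    (hp : Function.Periodic h (2 * Real.pi)) : IsHopfMetric P a b h (hopfMetric P a b h) :=
  (isHopfMetric_iff ha hb hp).2 (hopfMetric_apply h)

lemma IsHopfMetric.eq_hopfMetric (ha : Complex.exp a = P.α) (hb : Complex.exp b = P.β)
    {h : ℝ → ℝ} (hp : Function.Periodic h (2 * Real.pi)) {g : BilinField IS S1S3}
    (hg : IsHopfMetric P a b h g) : g = hopfMetric P a b h := by
  funext p
  ext v w
  rw [(isHopfMetric_iff ha hb hp).1 hg, hopfMetric_apply]

lemma conformal_hopfMetric (f : S1S3 → ℝ) (h : ℝ → ℝ) : conformal f (hopfMetric P a b h) =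
    pullbackBilin IS incl
      fun p => Real.exp (-f p) • ambientMetric P a b (circleFun h p.1) (incl p) := rfl

lemma conformal_hopfMetric_apply (f : S1S3 → ℝ) (h : ℝ → ℝ) (p : S1S3) (v w : TangentSpace IS p) :
    conformal f (hopfMetric P a b h) p v w = Real.exp (-f p) *
      hopfForm P (circleFun h p.1) p.2 (complexCoord a b p v) (complexCoord a b p w) := by
  rw [← hopfMetric_apply]
  rfl

lemma isHermitianMetricOn_conformal (ha : Complex.exp a = P.α) (hb : Complex.exp b = P.β)
    {h : ℝ → ℝ} (hs : ContDiff ℝ ∞ h) (hpos : ∀ t, 0 < h t)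
    (hp : Function.Periodic h (2 * Real.pi)) {U : Set S1S3} (hU : IsOpen U) {f : S1S3 → ℝ}
    (hf : ContMDiffOn IS 𝓘(ℝ, ℝ) ∞ f U) :
    IsHermitianMetricOn (hopfJ P a b) (conformal f (hopfMetric P a b h)) U where
  smooth p hpU := by
    rw [conformal_hopfMetric]
    refine (contMDiffAt_pullbackBilin (contMDiff_incl p) ?_).contMDiffWithinAt
    have h1 : ContMDiffAt IS 𝓘(ℝ, ℝ) ∞ (fun q => Real.exp (-f q)) p :=
      Real.contDiff_exp.contMDiff.contMDiffAt.comp p (hf.contMDiffAt (hU.mem_nhds hpU)).neg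
    have h2 : ContMDiffAt IS 𝓘(ℝ, ℝ × Ambient) ∞ (fun q => (circleFun h q.1, incl q)) p :=
      (contMDiff_circleFun hs hp p).prodMk_space (contMDiff_incl p)
    exact h1.smul ((contDiffAt_ambientMetric P a b _ p).contMDiffAt.comp p h2)
  symm p _ v w := by
    rw [conformal_hopfMetric_apply, conformal_hopfMetric_apply, hopfForm_symm]
  pos p _ v hv := by
    rw [conformal_hopfMetric_apply]
    refine mul_pos (Real.exp_pos _) (hopfForm_pos (hpos _) _ ?_)
    exact fun h0 => hv ((complexCoord_bijective (re_pos_left ha) (re_pos_right hb) p).1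
      (h0.trans (map_zero _).symm))
  isometry p _ v w := by
    rw [conformal_hopfMetric_apply, conformal_hopfMetric_apply, complexCoord_hopfJ ha hb,
      complexCoord_hopfJ ha hb, hopfForm_I_smul]

end Metric

/-! ### The exterior derivative of one-forms on vector spaces -/

section OneForm

variable {V : Type*} [NormedAddCommGroup V] [NormedSpace ℝ V]

/-- A covector as an alternating form of degree one. -/
def oneFormCLM (V : Type*) [NormedAddCommGroup V] [NormedSpace ℝ V] :
    (V →L[ℝ] ℝ) →L[ℝ] V [⋀^Fin 1]→L[ℝ] ℝ :=
  (ContinuousAlternatingMap.ofSubsingletonLIE (0 : Fin 1) :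
    (V →L[ℝ] ℝ) ≃ₗᵢ[ℝ] V [⋀^Fin 1]→L[ℝ] ℝ).toContinuousLinearEquiv.toContinuousLinearMap

lemma oneFormCLM_apply (ℓ : V →L[ℝ] ℝ) (v : Fin 1 → V) : oneFormCLM V ℓ v = ℓ (v 0) := rfl

/-- A field of covectors as a differential form of degree one. -/
def toOneForm (τ : V → V →L[ℝ] ℝ) : V → V [⋀^Fin 1]→L[ℝ] ℝ := oneFormCLM V ∘ τ

lemma contDiffAt_toOneForm {τ : V → V →L[ℝ] ℝ} {n : ℕ∞ω} {y : V} (h : ContDiffAt ℝ n τ y) :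
    ContDiffAt ℝ n (toOneForm τ) y :=
  (oneFormCLM V).contDiff.contDiffAt.comp y h

lemma extDeriv_toOneForm {τ : V → V →L[ℝ] ℝ} {L : V →L[ℝ] V →L[ℝ] ℝ} {y : V}
    (h : HasFDerivAt τ L y) (v : Fin 2 → V) :
    extDeriv (toOneForm τ) y v = L (v 0) (v 1) - L (v 1) (v 0) := by
  have h1 : HasFDerivAt (toOneForm τ) (oneFormCLM V ∘L L) y :=
    (oneFormCLM V).hasFDerivAt.comp y h
  rw [extDeriv, h1.fderiv, ContinuousAlternatingMap.alternatizeUncurryFin_apply,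
    Fin.sum_univ_two]
  simp [sub_eq_add_neg, Fin.removeNth, oneFormCLM_apply]
  rfl

lemma contDiffAt_extDeriv {k : ℕ} {η : V → V [⋀^Fin k]→L[ℝ] ℝ} {y : V}
    (h : ContDiffAt ℝ ∞ η y) : ContDiffAt ℝ 1 (extDeriv η) y := by
  have h1 : ContDiffAt ℝ 1 (fderiv ℝ η) y :=
    h.fderiv_right (by simpa [one_add_one_eq_two] using two_le_infty)
  have h2 : ContDiff ℝ 1 (ContinuousAlternatingMap.alternatizeUncurryFinCLM (n := k) ℝ V ℝ) :=
    ContinuousLinearMap.contDiff _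
  exact h2.contDiffAt.comp y h1

end OneForm

/-! ### Uniqueness of conformal factors -/

section LinearAlgebra

variable {T : Type*} [AddCommGroup T] [Module ℝ T]

/-- In real dimension greater than two, a covector `ℓ` with `ℓ ∧ B = 0` vanishes, if `B` is a form
with `B (Y, J Y) ≠ 0` for all `Y ≠ 0`. -/
lemma eq_zero_of_wedge_eq_zero {J : T →ₗ[ℝ] T} {ℓ : T →ₗ[ℝ] ℝ} {B : (Fin 2 → T) → ℝ}
    [FiniteDimensional ℝ T] (hT : 2 < Module.finrank ℝ T) (hB : ∀ Y, Y ≠ 0 → B ![Y, J Y] ≠ 0)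
    (h : ∀ v : Fin 3 → T, ∑ i, (-1) ^ i.val * (ℓ (v i) * B (i.removeNth v)) = 0) : ℓ = 0 := by
  -- Two real equations in dimension greater than two have a solution `Y ≠ 0` with `ℓ Y = ℓ (J Y) =
  -- 0`. On `(X, Y, J Y)` only the term `ℓ X * B (Y, J Y)` of the wedge product survives.
  have hker : LinearMap.ker (ℓ.prod (ℓ ∘ₗ J)) ≠ ⊥ :=
    LinearMap.ker_ne_bot_of_finrank_lt (by simpa using hT)
  obtain ⟨Y, hY, hY0⟩ := (Submodule.ne_bot_iff _).1 hker
  have h1 : ℓ Y = 0 := congrArg Prod.fst hY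
  have h2 : ℓ (J Y) = 0 := congrArg Prod.snd hY
  ext X
  have h3 := h ![X, Y, J Y]
  have h4 : (0 : Fin 3).removeNth ![X, Y, J Y] = ![Y, J Y] := by
    funext i
    fin_cases i <;> rfl
  rw [Fin.sum_univ_three, h4] at h3
  simp [h1, h2] at h3
  exact h3.resolve_right (hB Y hY0)

end LinearAlgebra

/-! ### Local potentials of the fundamental form -/

section Potential

/-- The primitive of `h` which vanishes at `0`. -/
def primitive (h : ℝ → ℝ) (θ : ℝ) : ℝ := ∫ t in (0 : ℝ)..θ, h t

lemma hasDerivAt_primitive {h : ℝ → ℝ} (hs : Continuous h) (θ : ℝ) :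
    HasDerivAt (primitive h) (h θ) θ := (hs.integral_hasStrictDerivAt 0 θ).hasDerivAt

lemma contDiff_primitive {h : ℝ → ℝ} (hs : ContDiff ℝ ∞ h) : ContDiff ℝ ∞ (primitive h) := by
  rw [contDiff_infty_iff_deriv]
  refine ⟨fun θ => (hasDerivAt_primitive hs.continuous θ).differentiableAt, ?_⟩
  rwa [show deriv (primitive h) = h from
    funext fun θ => (hasDerivAt_primitive hs.continuous θ).deriv]

/-- The local function `f` with `df = -h e¹`. -/
def localFactor (h : ℝ → ℝ) (θ₀ : ℝ) (p : S1S3) : ℝ := -primitive h (localArg θ₀ p.1)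

/-- A one-form on the ambient space whose differential restricts to the fundamental form of the
metric `e^{-f} g^h_{α,β}`, where `f = localFactor h θ₀`. -/
def potential (a b : ℂ) (h : ℝ → ℝ) (θ₀ : ℝ) (y : Ambient) : Ambient →L[ℝ] ℝ :=
  (Real.exp (primitive h (localArg θ₀ y.1)) * (2 * quad a.re b.re y)⁻¹) •
    (quad (a.im / (2 * Real.pi)) (b.im / (2 * Real.pi)) y • ambientCoframe 0 y + ambientCoframe 1 y)

variable {P : HopfPair} {a b : ℂ} {h : ℝ → ℝ} {θ₀ : ℝ} {p : S1S3}

lemma contDiffAt_primitive_localArg (hs : ContDiff ℝ ∞ h) (hp : p ∈ arcDomain θ₀) :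
    ContDiffAt ℝ ∞ (fun y : Ambient => primitive h (localArg θ₀ y.1)) (incl p) :=
  (contDiff_primitive hs).contDiffAt.comp (incl p) (contDiffAt_localArg hp)

lemma hasFDerivAt_primitive_localArg (hs : Continuous h) (hp : p ∈ arcDomain θ₀) :
    HasFDerivAt (fun y : Ambient => primitive h (localArg θ₀ y.1))
      (h (localArg θ₀ p.1) • ambientCoframe 0 (incl p)) (incl p) :=
  (hasDerivAt_primitive hs _).comp_hasFDerivAt (incl p) (hasFDerivAt_localArg hp)

lemma contMDiffAt_localFactor (hs : ContDiff ℝ ∞ h) (hp : p ∈ arcDomain θ₀) :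
    ContMDiffAt IS 𝓘(ℝ, ℝ) ∞ (localFactor h θ₀) p :=
  contMDiffAt_comp_incl le_rfl (contDiffAt_primitive_localArg hs hp).neg

lemma mvfderiv_localFactor (hs : Continuous h) (hp : p ∈ arcDomain θ₀) (v : TangentSpace IS p) :
    mvfderiv IS (localFactor h θ₀) p v = -(h (localArg θ₀ p.1) * coframeOne p v) := by
  refine (mvfderiv_comp_incl (hasFDerivAt_primitive_localArg hs hp).neg v).trans ?_
  rw [coframeOne_apply, ← ambientCoframe_mvfderiv_incl]
  rfl

lemma quad_re_eq_reG (ha : Complex.exp a = P.α) (hb : Complex.exp b = P.β) (p : S1S3) :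
    quad a.re b.re (incl p) = reG P p.2 := by
  rw [reG_eq_quad, re_eq_log_norm ha, re_eq_log_norm hb]

lemma quad_re_ne_zero (ha : Complex.exp a = P.α) (hb : Complex.exp b = P.β) (p : S1S3) :
    quad a.re b.re (incl p) ≠ 0 := by
  rw [quad_re_eq_reG ha hb]
  exact (reG_pos P p.2).ne'

lemma contDiffAt_potential (ha : Complex.exp a = P.α) (hb : Complex.exp b = P.β)
    (hs : ContDiff ℝ ∞ h) (hp : p ∈ arcDomain θ₀) :
    ContDiffAt ℝ ∞ (potential a b h θ₀) (incl p) := by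
  have h1 : ContDiffAt ℝ ∞ (fun y : Ambient => (2 * quad a.re b.re y)⁻¹) (incl p) :=
    (contDiffAt_const.mul (contDiff_quad _ _).contDiffAt).inv
      (mul_ne_zero two_ne_zero (quad_re_ne_zero ha hb p))
  have h2 : ContDiff ℝ ∞ (fun y => quad (a.im / (2 * Real.pi)) (b.im / (2 * Real.pi)) y •
      ambientCoframe 0 y + ambientCoframe 1 y) :=
    ((contDiff_quad _ _).smul (ambientCoframe 0).contDiff).add (ambientCoframe 1).contDiff
  exact ((contDiffAt_primitive_localArg hs hp).exp.mul h1).smul h2.contDiffAt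

/-- The differential of `quad κ₁ κ₂` along `S¹ × S³`, in terms of the coordinates in the frame. -/
def quadDiff (κ₁ κ₂ : ℝ) (w : ℂ) (x : Fin 4 → ℝ) : ℝ :=
  2 * (κ₂ - κ₁) * (w.re * x 2 + w.im * x 3)

/-- The fields `e₁` and `e₂` preserve `|ξ₁|` and `|ξ₂|`, so only the components along `e₃` and `e₄`
contribute. As `|ξ₁|² + |ξ₂|²` is constant, only `κ₂ - κ₁` matters. -/
lemma exists_hasFDerivAt_quad (κ₁ κ₂ : ℝ) (p : S1S3) : ∃ L : Ambient →L[ℝ] ℝ,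
    HasFDerivAt (quad κ₁ κ₂) L (incl p) ∧ ∀ v : TangentSpace IS p, L (mvfderiv IS incl p v) =
      quadDiff κ₁ κ₂ (xi1 p.2 * xi2 p.2) (frameCoord p v) := by
  have h1 : ∀ i, HasFDerivAt (fun y : Ambient => y.2 i) (ambientCoord i) (incl p) :=
    fun i => (ambientCoord i).hasFDerivAt
  refine ⟨_, ((((h1 0).pow 2).add ((h1 1).pow 2)).const_mul κ₁).add
    ((((h1 2).pow 2).add ((h1 3).pow 2)).const_mul κ₂), fun v => ?_⟩
  simp [mvfderiv_incl_snd, quadDiff, incl, xi1, xi2]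
  ring

/-- The tangent line of the circle is one-dimensional; this says that `e¹` is closed. -/
lemma ambientCoframe_zero_mvfderiv_incl (p : S1S3) (v w : TangentSpace IS p) :
    ambientCoframe 0 (mvfderiv IS incl p v) (mvfderiv IS incl p w) = 0 := by
  rw [ambientCoframe_zero, mvfderiv_incl_fst, mvfderiv_incl_fst]
  simp
  ring

/-- The bilinear form is `⟨iv, w⟩`, and `i e₂` is normal to the sphere. Since `ambientCoframe 1` is
linear in the base point, antisymmetrizing gives `de² = 2 e³ ∧ e⁴`, which explains the `2` in
`potential`. -/
lemma ambientCoframe_one_mvfderiv_incl (p : S1S3) (v w : TangentSpace IS p) :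
    ambientCoframe 1 (mvfderiv IS incl p v) (mvfderiv IS incl p w) =
      frameCoord p v 2 * frameCoord p w 3 - frameCoord p v 3 * frameCoord p w 2 := by
  have hQ := S3_sum_sq p.2
  rw [ambientCoframe_one, mvfderiv_incl_snd, mvfderiv_incl_snd]
  simp
  linear_combination
    (frameCoord p v 2 * frameCoord p w 3 - frameCoord p v 3 * frameCoord p w 2) * hQ

/-- The differential of `potential a b h θ₀`, divided by `e^{-f}`, in terms of the coordinates in
the frame; here `G`, `m`, `t` and `w` are the values of `ℜ G`, `ℑ G / 2π`, `h` and `ξ₁ ξ₂`. -/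
def potentialDiff (a b : ℂ) (G m t : ℝ) (w : ℂ) (x y : Fin 4 → ℝ) : ℝ :=
  (t * x 0 / (2 * G) - quadDiff a.re b.re w x / (2 * G ^ 2)) * (m * y 0 + y 1) +
    (quadDiff (a.im / (2 * Real.pi)) (b.im / (2 * Real.pi)) w x * y 0 +
      (x 2 * y 3 - x 3 * y 2)) / (2 * G)

lemma exists_hasFDerivAt_potential (ha : Complex.exp a = P.α) (hb : Complex.exp b = P.β)
    (hs : Continuous h) (hp : p ∈ arcDomain θ₀) : ∃ L : Ambient →L[ℝ] Ambient →L[ℝ] ℝ,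
    HasFDerivAt (potential a b h θ₀) L (incl p) ∧ ∀ v w : TangentSpace IS p,
      L (mvfderiv IS incl p v) (mvfderiv IS incl p w) = Real.exp (-localFactor h θ₀ p) *
        potentialDiff a b (reG P p.2) (coefC a b p.2).im (h (localArg θ₀ p.1))
          (xi1 p.2 * xi2 p.2) (frameCoord p v) (frameCoord p w) := by
  obtain ⟨Lr, hr, hr'⟩ := exists_hasFDerivAt_quad a.re b.re p
  obtain ⟨Lm, hm, hm'⟩ :=
    exists_hasFDerivAt_quad (a.im / (2 * Real.pi)) (b.im / (2 * Real.pi)) p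
  have h1 := (hasFDerivAt_primitive_localArg hs hp).exp
  have hne := mul_ne_zero (two_ne_zero (α := ℝ)) (quad_re_ne_zero ha hb p)
  have h2 := (hasDerivAt_inv hne).comp_hasFDerivAt (incl p) (hr.const_mul 2)
  have h3 := (hm.smul (ambientCoframe 0).hasFDerivAt).add (ambientCoframe 1).hasFDerivAt
  refine ⟨_, (h1.mul h2).smul h3, fun v w => ?_⟩
  have hG := reG_pos P p.2
  have hE : -localFactor h θ₀ p = primitive h (localArg θ₀ (incl p).1) := by
    rw [localFactor, neg_neg]
    rfl
  rw [hE]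
  simp only [add_apply, smul_apply, ContinuousLinearMap.smulRight_apply, smul_eq_mul, hr', hm',
    Pi.add_apply, Pi.mul_apply, Pi.smul_apply',
    ambientCoframe_zero_mvfderiv_incl, ambientCoframe_one_mvfderiv_incl,
    ambientCoframe_mvfderiv_incl, Function.comp_apply, quad_re_eq_reG ha hb, ← coefC_im_eq_quad,
    potentialDiff]
  field_simp
  ring

/-- This is the heart of the Kähler property: the left side is `g(Jv, w)`, the right side is `dσ(v,
w)` without the factor `e^{-f}`. Once `log (|α|/|β|) = Re a - Re b` and `Re C = Re G / 2π` are
inserted, it is a rational identity in the frame coordinates; `Im a` and `Im b` enter through `C`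
and `D` on the left and through `Im C` and its differential on the right. -/
lemma hopfForm_complexCoord_eq (ha : Complex.exp a = P.α) (hb : Complex.exp b = P.β) (t : ℝ)
    (p : S1S3) (v w : TangentSpace IS p) :
    hopfForm P t p.2 (Complex.I • complexCoord a b p v) (complexCoord a b p w) =
      potentialDiff a b (reG P p.2) (coefC a b p.2).im t (xi1 p.2 * xi2 p.2)
          (frameCoord p v) (frameCoord p w) -
        potentialDiff a b (reG P p.2) (coefC a b p.2).im t (xi1 p.2 * xi2 p.2)
          (frameCoord p w) (frameCoord p v) := by
  have hw : ‖xi1 p.2‖ ^ 2 * ‖xi2 p.2‖ ^ 2 =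
      (xi1 p.2 * xi2 p.2).re ^ 2 + (xi1 p.2 * xi2 p.2).im ^ 2 := by
    rw [← mul_pow, ← norm_mul, ← Complex.normSq_eq_norm_sq, Complex.normSq_apply]
    ring
  have hL : Real.log (‖P.α‖ / ‖P.β‖) = a.re - b.re := by
    rw [Real.log_div (norm_ne_zero_iff.2 P.α_ne) (norm_ne_zero_iff.2 P.β_ne),
      re_eq_log_norm ha, re_eq_log_norm hb]
  have hr : (coefC a b p.2).re = reG P p.2 / (2 * Real.pi) := by
    rw [coefC_re, reG, re_eq_log_norm ha, re_eq_log_norm hb]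
    ring
  have hG := reG_pos P p.2
  have hpi := Real.pi_pos
  have hD : coefD a b p.2 = (b - a) * (xi1 p.2 * xi2 p.2) / (2 * Real.pi : ℝ) := by
    rw [coefD, Complex.ofReal_mul, Complex.ofReal_ofNat]
  have h0 : ∀ v : TangentSpace IS p, complexCoord a b p v 0 =
      ⟨frameCoord p v 1 + (coefC a b p.2).im * frameCoord p v 0,
        -(reG P p.2 / (2 * Real.pi) * frameCoord p v 0)⟩ := fun v => by
    rw [complexCoord_zero, ← hr]
    apply Complex.ext <;> simp
  have h1 : ∀ v : TangentSpace IS p, complexCoord a b p v 1 =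
      ⟨frameCoord p v 2 + ((b.re - a.re) * (xi1 p.2 * xi2 p.2).re -
          (b.im - a.im) * (xi1 p.2 * xi2 p.2).im) / (2 * Real.pi) * frameCoord p v 0,
        frameCoord p v 3 + ((b.re - a.re) * (xi1 p.2 * xi2 p.2).im +
          (b.im - a.im) * (xi1 p.2 * xi2 p.2).re) / (2 * Real.pi) * frameCoord p v 0⟩ := fun v => by
    rw [complexCoord_one, hD]
    generalize xi1 p.2 * xi2 p.2 = z
    generalize 2 * Real.pi = s
    apply Complex.ext
    · simp only [Complex.add_re, Complex.div_ofReal_re, Complex.mul_re,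
        Complex.sub_re, Complex.sub_im, Complex.ofReal_re, Complex.I_re, Complex.I_im,
        Complex.ofReal_im]
      ring
    · simp only [Complex.add_im, Complex.div_ofReal_im, Complex.mul_im,
        Complex.sub_re, Complex.sub_im, Complex.ofReal_re, Complex.I_re, Complex.I_im,
        Complex.ofReal_im]
      ring
  rw [hopfForm_eq, hw, hL]
  simp only [Pi.smul_apply, smul_eq_mul, Complex.I_mul_re, Complex.I_mul_im, h0, h1, potentialDiff,
    quadDiff]
  generalize (xi1 p.2 * xi2 p.2).re = S
  generalize (xi1 p.2 * xi2 p.2).im = T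
  generalize (coefC a b p.2).im = m
  field_simp
  ring

end Potential

/-! ### The metric is locally conformal Kähler -/

section LCK

variable {P : HopfPair} {a b : ℂ} {h : ℝ → ℝ} {θ₀ : ℝ} {p : S1S3}

/-- The fundamental form of the Kähler metric `e^{-f} g^h_{α,β}`, where `f = localFactor h θ₀`. -/
def localForm (a b : ℂ) (h : ℝ → ℝ) (θ₀ : ℝ) : DiffForm IS S1S3 2 :=
  pullbackForm IS incl (extDeriv (toOneForm (potential a b h θ₀)))

lemma localForm_apply (ha : Complex.exp a = P.α) (hb : Complex.exp b = P.β) (hs : Continuous h)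
    (hp : Function.Periodic h (2 * Real.pi)) (hmem : p ∈ arcDomain θ₀)
    (v : Fin 2 → TangentSpace IS p) : localForm a b h θ₀ p v =
      Real.exp (-localFactor h θ₀ p) * hopfMetric P a b h p (hopfJ P a b p (v 0)) (v 1) := by
  obtain ⟨L, hL, hL'⟩ := exists_hasFDerivAt_potential ha hb hs hmem
  rw [localForm, pullbackForm_apply, extDeriv_toOneForm hL, hL', hL', hopfMetric_apply,
    complexCoord_hopfJ ha hb, hopfForm_complexCoord_eq ha hb, circleFun_eq_localArg hp θ₀]
  ring

lemma differentiableAt_extDeriv_potential (ha : Complex.exp a = P.α) (hb : Complex.exp b = P.β)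
    (hs : ContDiff ℝ ∞ h) (hmem : p ∈ arcDomain θ₀) :
    DifferentiableAt ℝ (extDeriv (toOneForm (potential a b h θ₀))) (incl p) :=
  (contDiffAt_extDeriv (contDiffAt_toOneForm
    (contDiffAt_potential ha hb hs hmem))).differentiableAt one_ne_zero

/-- The form is the restriction of an exact form on the ambient space, where `d ∘ d = 0`. -/
lemma extD_localForm (ha : Complex.exp a = P.α) (hb : Complex.exp b = P.β) (hs : ContDiff ℝ ∞ h)
    (hmem : p ∈ arcDomain θ₀) : extD (localForm a b h θ₀) p = 0 := by
  rw [localForm,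
    extD_pullbackForm contMDiff_incl (differentiableAt_extDeriv_potential ha hb hs hmem)]
  ext v
  rw [pullbackForm_apply, extDeriv_extDeriv_apply
    (contDiffAt_toOneForm (contDiffAt_potential ha hb hs hmem)) (by simpa using two_le_infty)]
  rfl

lemma isKahlerMetricOn_arcDomain (ha : Complex.exp a = P.α) (hb : Complex.exp b = P.β)
    (hs : ContDiff ℝ ∞ h) (hpos : ∀ t, 0 < h t) (hp : Function.Periodic h (2 * Real.pi)) (θ₀ : ℝ) :
    IsKahlerMetricOn (hopfJ P a b) (conformal (localFactor h θ₀) (hopfMetric P a b h))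
      (arcDomain θ₀) :=
  ⟨isHermitianMetricOn_conformal ha hb hs hpos hp (isOpen_arcDomain θ₀)
    fun _ hq => (contMDiffAt_localFactor hs hq).contMDiffWithinAt, localForm a b h θ₀,
    fun _ hq v => localForm_apply ha hb hs.continuous hp hq v,
    fun _ hq => extD_localForm ha hb hs hq⟩

lemma isHermitianMetricOn_hopfMetric (ha : Complex.exp a = P.α) (hb : Complex.exp b = P.β)
    (hs : ContDiff ℝ ∞ h) (hpos : ∀ t, 0 < h t) (hp : Function.Periodic h (2 * Real.pi)) :
    IsHermitianMetricOn (hopfJ P a b) (hopfMetric P a b h) Set.univ := by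
  have h1 := isHermitianMetricOn_conformal ha hb hs hpos hp isOpen_univ
    (f := fun _ => 0) contMDiffOn_const
  have h2 : conformal (fun _ => 0) (hopfMetric P a b h) = hopfMetric P a b h := by
    funext p
    simp [conformal]
  rwa [h2] at h1

lemma isLCK_hopfMetric (ha : Complex.exp a = P.α) (hb : Complex.exp b = P.β)
    (hs : ContDiff ℝ ∞ h) (hpos : ∀ t, 0 < h t) (hp : Function.Periodic h (2 * Real.pi)) :
    IsLCK (hopfJ P a b) (hopfMetric P a b h) :=
  ⟨isComplexStructure_hopfJ ha hb, isHermitianMetricOn_hopfMetric ha hb hs hpos hp, fun p =>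
    ⟨_, isOpen_arcDomain _, mem_arcDomain_arg p, localFactor h _,
      fun _ hq => (contMDiffAt_localFactor hs hq).contMDiffWithinAt,
      isKahlerMetricOn_arcDomain ha hb hs hpos hp _⟩⟩

lemma two_lt_finrank_tangentSpace (p : S1S3) : 2 < Module.finrank ℝ (TangentSpace IS p) := by
  rw [Module.finrank_eq_card_basis (frame p)]
  simp

/-- Two local conformal factors which make `g^h_{α,β}` a Kähler metric have the same
differential. -/
lemma mvfderiv_eq_of_isKahlerMetricOn (ha : Complex.exp a = P.α) (hb : Complex.exp b = P.β)
    (hs : ContDiff ℝ ∞ h) (hpos : ∀ t, 0 < h t) (hp : Function.Periodic h (2 * Real.pi))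
    {U : Set S1S3} {f : S1S3 → ℝ} (hU : U ∈ 𝓝 p) (hf : ContMDiffAt IS 𝓘(ℝ, ℝ) ∞ f p)
    (hK : IsKahlerMetricOn (hopfJ P a b) (conformal f (hopfMetric P a b h)) U)
    (hmem : p ∈ arcDomain θ₀) : mvfderiv IS f p = mvfderiv IS (localFactor h θ₀) p := by
  obtain ⟨-, Ω, hΩ, hd⟩ := hK
  have hf₀ := contMDiffAt_localFactor hs hmem
  have hsub : ContMDiffAt IS 𝓘(ℝ, ℝ) ∞ (localFactor h θ₀ - f) p := hf₀.sub hf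
  have hφ : ContMDiffAt IS 𝓘(ℝ, ℝ) ∞ (Real.exp ∘ (localFactor h θ₀ - f)) p :=
    Real.contDiff_exp.contMDiff.contMDiffAt.comp p hsub
  -- Both forms are multiples of `g(J·, ·)`, by `e^{-f}` and `e^{-f₀}` with `f₀ = localFactor h θ₀`;
  -- their ratio is `φ = e^{f₀ - f}`.
  have heq : ∀ᶠ q in 𝓝 p, Ω q =
      (Real.exp ∘ (localFactor h θ₀ - f)) q • localForm a b h θ₀ q := by
    filter_upwards [hU, (isOpen_arcDomain θ₀).mem_nhds hmem] with q hq hq'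
    ext v
    rw [hΩ q hq, ContinuousAlternatingMap.smul_apply, localForm_apply ha hb hs.continuous hp hq',
      smul_eq_mul, ← mul_assoc, Function.comp_apply, ← Real.exp_add, Pi.sub_apply]
    rw [show localFactor h θ₀ q - f q + -localFactor h θ₀ q = -f q by ring]
    rfl
  have hzero : extD (fun q => (Real.exp ∘ (localFactor h θ₀ - f)) q • localForm a b h θ₀ q) p = 0 :=
    (extD_congr heq).symm.trans (hd p (mem_of_mem_nhds hU))
  -- Both `φ • localForm` and `localForm` are closed at `p`, so the Leibniz rule leaves `dφ ∧
  -- localForm = 0`.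
  have hwedge : ∀ v : Fin 3 → TangentSpace IS p, ∑ i, (-1) ^ i.val *
      (mvfderiv IS (Real.exp ∘ (localFactor h θ₀ - f)) p (v i) *
        localForm a b h θ₀ p (i.removeNth v)) = 0 := fun v => by
    have h1 := extD_smul_apply (hφ.of_le (by simp)) (differentiableAt_formInChart_pullbackForm
      contMDiff_incl (differentiableAt_extDeriv_potential ha hb hs hmem)) v
    rw [← localForm, hzero, extD_localForm ha hb hs hmem] at h1
    simpa using h1.symm
  have : FiniteDimensional ℝ (TangentSpace IS p) := (frame p).finiteDimensional_of_finite
  have hH := isHermitianMetricOn_hopfMetric ha hb hs hpos hp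
  -- The value of `localForm` on `(Y, JY)` is a positive multiple of `g(JY, JY) = g(Y, Y)`, so it is
  -- nonzero for `Y ≠ 0`. Hence `dφ = 0`, and by the chain rule `df = df₀` at `p`.
  have hdφ := eq_zero_of_wedge_eq_zero (J := (hopfJ P a b p).toLinearMap)
    (ℓ := (mvfderiv IS (Real.exp ∘ (localFactor h θ₀ - f)) p).toLinearMap)
    (B := localForm a b h θ₀ p) (two_lt_finrank_tangentSpace p) (fun Y hY => by
      rw [localForm_apply ha hb hs.continuous hp hmem]
      refine (mul_pos (Real.exp_pos _) ?_).ne'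
      change 0 < hopfMetric P a b h p (hopfJ P a b p Y) (hopfJ P a b p Y)
      rw [hH.isometry p trivial]
      exact hH.pos p trivial Y hY) hwedge
  have hchain : ∀ v, mvfderiv IS (Real.exp ∘ (localFactor h θ₀ - f)) p v =
      mvfderiv IS (localFactor h θ₀ - f) p v * Real.exp ((localFactor h θ₀ - f) p) := fun v => by
    have h1 := mfderiv_comp_apply p
      (Real.differentiable_exp ((localFactor h θ₀ - f) p)).mdifferentiableAt
      (hsub.mdifferentiableAt (by simp)) v
    rw [mfderiv_eq_fderiv] at h1
    refine h1.trans ?_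
    rw [(Real.hasDerivAt_exp _).hasFDerivAt.fderiv]
    rfl
  ext v
  have h2 := (hchain v).symm.trans (LinearMap.congr_fun hdφ v)
  rw [mvfderiv_sub (hf₀.mdifferentiableAt (by simp)) (hf.mdifferentiableAt (by simp))] at h2
  have h3 := (mul_eq_zero.1 h2).resolve_right (Real.exp_ne_zero _)
  exact (sub_eq_zero.1 h3).symm

/-- The one-form `-h e¹`. -/
def negHCoframe (h : ℝ → ℝ) (p : S1S3) : TangentSpace IS p →L[ℝ] ℝ :=
  -circleFun h p.1 • coframeOne p

lemma isNegHCoframe_iff (hp : Function.Periodic h (2 * Real.pi))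
    {η : Π p : S1S3, TangentSpace IS p →L[ℝ] ℝ} : IsNegHCoframe h η ↔ η = negHCoframe h := by
  constructor
  · intro H
    funext ⟨z, Q⟩
    obtain ⟨θ, rfl⟩ := Circle.exp_surjective z
    rw [H, negHCoframe, circleFun_exp hp]
  · rintro rfl θ Q
    rw [negHCoframe, circleFun_exp hp]

lemma isLeeForm_hopfMetric (ha : Complex.exp a = P.α) (hb : Complex.exp b = P.β)
    (hs : ContDiff ℝ ∞ h) (hpos : ∀ t, 0 < h t) (hp : Function.Periodic h (2 * Real.pi)) :
    IsLeeForm (hopfJ P a b) (hopfMetric P a b h) (negHCoframe h) := by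
  intro U f hU hf hK p hpU
  have hmem := mem_arcDomain_arg p
  have hUp := hU.mem_nhds hpU
  rw [mvfderiv_eq_of_isKahlerMetricOn ha hb hs hpos hp hUp (hf.contMDiffAt hUp) hK hmem]
  ext v
  rw [mvfderiv_localFactor hs.continuous hmem, ← circleFun_eq_localArg hp, ← neg_mul]
  rfl

end LCK

end HopfLCK

end

theorem mainTheorem4 (P : HopfPair) (a b : ℂ) (ha : Complex.exp a = P.α)
    (hb : Complex.exp b = P.β) (h : ℝ → ℝ) (h_smooth : ContDiff ℝ ∞ h) (h_pos : ∀ t, 0 < h t)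
    (h_per : Function.Periodic h (2 * Real.pi)) :
    -- `F_{α,β}` is a diffeomorphism and `J_{α,β}` corresponds to `i`
    (∃ Φ : S1S3 ≃ₘ⟮IS, 𝓘(ℝ, ℂ × ℂ)⟯ HopfSurface P,
      (∀ (θ : ℝ) (Q : S3), Φ (Circle.exp θ, Q) = HopfSurface.mk (hopfLift P a b θ Q)) ∧
      ∀ (p : S1S3) (v : TangentSpace IS p),
        mfderiv IS 𝓘(ℝ, ℂ × ℂ) Φ p (hopfJ P a b p v) =
          hopfI P (Φ p) (mfderiv IS 𝓘(ℝ, ℂ × ℂ) Φ p v)) ∧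
    -- `(e₂, e₃)` is a complex basis of the tangent spaces
    (∀ p : S1S3, IsComplexBasis (hopfJ P a b p) (frame p 1) (frame p 2)) ∧
    -- the metric `g^h_{α,β}` and the form `-h e¹` are well defined
    (∃! g : BilinField IS S1S3, IsHopfMetric P a b h g) ∧
    (∃! η : Π p : S1S3, TangentSpace IS p →L[ℝ] ℝ, IsNegHCoframe h η) ∧
    -- the metric is l.c.K. and its Lee form is `-h e¹`
    ∀ g : BilinField IS S1S3, IsHopfMetric P a b h g →
      IsLCK (hopfJ P a b) g ∧
      ∀ η : Π p : S1S3, TangentSpace IS p →L[ℝ] ℝ, IsNegHCoframe h η →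
        IsLeeForm (hopfJ P a b) g η := by
  refine ⟨⟨hopfDiffeomorph ha hb,
    fun θ Q => hopfMap_eq_of_exp_eq (p := (Circle.exp θ, Q)) ha hb rfl,
    mfderiv_hopfMap_hopfJ ha hb⟩, isComplexBasis_hopfJ ha hb,
    ⟨hopfMetric P a b h, isHopfMetric_hopfMetric ha hb h_per,
      fun g hg => hg.eq_hopfMetric ha hb h_per⟩,
    ⟨negHCoframe h, (isNegHCoframe_iff h_per).2 rfl, fun η => (isNegHCoframe_iff h_per).1⟩, ?_⟩
  intro g hg
  rw [hg.eq_hopfMetric ha hb h_per]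
  refine ⟨isLCK_hopfMetric ha hb h_smooth h_pos h_per, fun η hη => ?_⟩
  rw [(isNegHCoframe_iff h_per).1 hη]
  exact isLeeForm_hopfMetric ha hb h_smooth h_pos h_per
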